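/- Let $k$ be a finite field with $q^n$ elements, let $k'\subseteq k$ be its subfield with $q$ elements, let $R=k[X_0,\ldots,X_{m-1}]$, let $\mathcal F\subset R$ be a finite subset and let $I$ be the ideal it generates. Write $Z(\mathcal F)\subseteq\overline{k}^{\,m}$ for the set of common zeros of $\mathcal F$ over the algebraic closure, and $\deg(\mathcal F)$ for the maximum of the total degrees of the elements of $\mathcal F$ (where the zero polynomial is given degree $0$). For a polynomial ring $P$ over a field $K$, a finite system $\mathcal H\subset P$ and $i\in\mathbb Z_{\ge 0}\cup\{\infty\}$, let $V_{\mathcal H,i}$ be the smallest $K$-subspace of $P$ that contains every $f\in\mathcal H$ with $\deg f\le i$ and that contains $hg$ whenever $g\in V_{\mathcal H,i}$, $h\in P$ and $\deg(hg)\le i$ (so $V_{\mathcal H,\infty}$ is the ideal generated by $\mathcal H$). The *last fall degree* $d_{\mathcal H}$ is the minimal $d\in\mathbb Z_{\ge 0}\cup\{\infty\}$ such that $f\in V_{\mathcal H,\max(d,\deg f)}$ for every $f$ in the ideal generated by $\mathcal H$. Let $\alpha_0,\ldots,\alpha_{n-1}$ be any basis of $k$ over $k'$. For $f\in\mathcal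 F$ let $[f]_0,\ldots,[f]_{n-1}\in k'[X_{ij}: 0\le i<m,\ 0\le j<n]$ be the polynomials of degree at most $q-1$ in each variable such that $$f\Big(\sum_j\alpha_jX_{0j},\ldots,\sum_j\alpha_jX_{m-1\,j}\Big)\equiv\sum_j \alpha_j\,[f]_j \pmod{X_{ij}^q-X_{ij}\ \text{for all } i,j},$$ and let $\mathcal F'_f=\{[f]_j: f\in\mathcal F,\ 0\le j<n\}\cup\{X_{ij}^q-X_{ij}: 0\le i<m,\ 0\le j<n\}$ be the Weil descent system of $\mathcal F$ to $k'$ together with the field equations. For integers $r\ge 0$, $c\ge 2$ and $t\ge 1$ put $\tau(r,c,t)=\max\big(\lfloor 2t(c-1)(\log_c(\tfrac{r}{2t})+1)\rfloor,\,0\big)$, with $\tau(0,c,t)=0$. **Theorem.** Let $s\ge 1$ be an integer. Assume that $Z(\mathcal F)$ is finite with $|Z(\mathcal F)|\le s$ (so $I$ is zero-dimensional, where for $s\geq 1$ the unit ideal is also allowed), that $I$ is radical, and that there is a coordinate $t\in\{0,\ldots,m-1\}$ for which the projection $Z(\mathcal F)\to\overline k$ to coordinate $t$ is injective. Then $d_{\mathcal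 F}$ is finite and $$d_{\mathcal F'_f}\le\max\Big(\tau\big(\max(d_{\mathcal F},\deg(\mathcal F),(m+1)s,1),q,m\big),\ m\cdot\tau(2s,q,1),\ q\Big).$$ In particular, the bound does not involve $n$. -/

import Mathlib

noncomputable section

namespace WeilDescent

open MvPolynomial

section LastFall

variable {σ K : Type*} [Field K]

/-- `V_{F,i}`: the smallest `K`-subspace `W` of the polynomial ring that contains every element of
`F` of degree at most `i` and that contains `h * g` whenever `g ∈ W` and `deg (h * g) ≤ i`.
For `i = ⊤` there is no degree condition and this is the ideal generated by `F`
(see `constructible_top`). -/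
def constructible (F : Set (MvPolynomial σ K)) (i : ℕ∞) : Submodule K (MvPolynomial σ K) :=
  sInf {W | (∀ f ∈ F, (f.totalDegree : ℕ∞) ≤ i → f ∈ W) ∧
    ∀ g ∈ W, ∀ h : MvPolynomial σ K, ((h * g).totalDegree : ℕ∞) ≤ i → h * g ∈ W}

theorem constructible_top (F : Set (MvPolynomial σ K)) :
    constructible F ⊤ = (Ideal.span F).restrictScalars K := by
  apply le_antisymm
  · refine sInf_le ⟨fun f hf _ => Ideal.subset_span hf, fun g hg h _ => ?_⟩
    exact Ideal.mul_mem_left (Ideal.span F) h hg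
  · refine le_sInf ?_
    rintro W ⟨h1, h2⟩ x hx
    have hx' : x ∈ Ideal.span F := hx
    clear hx
    induction hx' using Submodule.span_induction with
    | mem x hx => exact h1 x hx le_top
    | zero => exact W.zero_mem
    | add x y hx hy ihx ihy => exact W.add_mem ihx ihy
    | smul a x hx ih => exact h2 x ih a le_top

/-- The last fall degree `d_F` of a system `F`: the minimal `d ∈ ℤ_{≥0} ∪ {∞}` such that every
element `f` of the ideal generated by `F` lies in `V_{F, max (d, deg f)}`. -/
def lastFallDegree (F : Set (MvPolynomial σ K)) : ℕ∞ :=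
  sInf {d : ℕ∞ | ∀ f ∈ Ideal.span F, f ∈ constructible F (max d (f.totalDegree : ℕ∞))}

/-- `deg F`, the maximum of the total degrees of the elements of the finite system `F`. -/
def systemDegree (F : Finset (MvPolynomial σ K)) : ℕ :=
  F.sup MvPolynomial.totalDegree

/-- The set `Z(F)` of common zeros of `F` over the algebraic closure of `K`. -/
def zeroSet (F : Set (MvPolynomial σ K)) : Set (σ → AlgebraicClosure K) :=
  {x | ∀ f ∈ F, aeval x f = 0}

end LastFall

/-- `τ(r,c,t) = max (⌊2t(c-1)(log_c (r/(2t)) + 1)⌋, 0)`. The natural-number floor of a negative real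
is `0`; for `r = 0` the logarithm is `-∞`, so that the value is `0`. -/
def tau (r c t : ℕ) : ℕ :=
  if r = 0 then 0
  else ⌊2 * (t : ℝ) * ((c : ℝ) - 1) * (Real.logb (c : ℝ) ((r : ℝ) / (2 * (t : ℝ))) + 1)⌋₊

section Descent

/-- The exponent `e'` of the remainder `X ^ e'` of division of `X ^ e` by `X ^ q - X`. -/
def reduceExp (q e : ℕ) : ℕ :=
  if e = 0 then 0 else (e - 1) % (q - 1) + 1

@[simp] theorem reduceExp_zero (q : ℕ) : reduceExp q 0 = 0 := by
  simp [reduceExp]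

variable {k' k : Type*} [Field k'] [Field k] [Algebra k' k] {m n : ℕ}

/-- The polynomial `f (∑ j, α_j X_{0 j}, …, ∑ j, α_j X_{m-1 j})` in the variables `X_{i j}`. -/
def substituted (α : Module.Basis (Fin n) k' k) (f : MvPolynomial (Fin m) k) :
    MvPolynomial (Fin m × Fin n) k :=
  aeval (fun i => ∑ j, C (α j) * X (i, j)) f

/-- The `j`-th component `[f]_j` over `k'`: in `f (∑ j, α_j X_{0 j}, …)` every monomial is reduced
modulo the `X_{i j} ^ q - X_{i j}`, and the `α_j`-coordinate of every coefficient is taken.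
Its characteristic properties are `degreeOf_weilComponent_le` and `weilComponent_congr`. -/
def weilComponent (q : ℕ) (α : Module.Basis (Fin n) k' k) (f : MvPolynomial (Fin m) k)
    (j : Fin n) : MvPolynomial (Fin m × Fin n) k' :=
  ∑ e ∈ (substituted α f).support,
    monomial (e.mapRange (reduceExp q) (reduceExp_zero q))
      (α.repr ((substituted α f).coeff e) j)

/-- The Weil descent system of `F` with respect to the basis `α`, together with the field
equations `X_{i j} ^ q - X_{i j}`. -/
def weilDescentSystem (q : ℕ) (α : Module.Basis (Fin n) k' k) (F : Set (MvPolynomial (Fin m) k)) :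
    Set (MvPolynomial (Fin m × Fin n) k') :=
  {g | ∃ f ∈ F, ∃ j : Fin n, g = weilComponent q α f j} ∪
    {g | ∃ p : Fin m × Fin n, g = X p ^ q - X p}

/-- `deg_{X_{i j}} [f]_l ≤ q - 1`. -/
theorem degreeOf_weilComponent_le (q : ℕ) (hq : 2 ≤ q) (α : Module.Basis (Fin n) k' k)
    (f : MvPolynomial (Fin m) k) (j : Fin n) (p : Fin m × Fin n) :
    (weilComponent q α f j).degreeOf p ≤ q - 1 := by
  classical
  refine (degreeOf_sum_le p _ _).trans (Finset.sup_le fun e _ => ?_)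
  by_cases hc : α.repr ((substituted α f).coeff e) j = 0
  · simp [hc]
  · rw [degreeOf_monomial_eq _ _ hc, Finsupp.mapRange_apply]
    unfold reduceExp
    split_ifs
    · omega
    · have := Nat.mod_lt (e p - 1) (show 0 < q - 1 by omega)
      omega

theorem pow_reduceExp_congr {A : Type*} [CommRing A] (q : ℕ) (hq : 2 ≤ q) (x : A)
    (hx : x ^ q = x) (e : ℕ) : x ^ reduceExp q e = x ^ e := by
  unfold reduceExp
  split_ifs with h
  · simp [h]
  · have key : ∀ a b : ℕ, x ^ ((q - 1) * a + b + 1) = x ^ (b + 1) := by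
      intro a b
      induction a with
      | zero => simp
      | succ a ih =>
        have : (q - 1) * (a + 1) + b + 1 = q + ((q - 1) * a + b) := by
          rw [Nat.mul_succ]; omega
        rw [this, pow_add, hx, ← pow_succ', ih]
    have h2 := key ((e - 1) / (q - 1)) ((e - 1) % (q - 1))
    rw [Nat.div_add_mod, Nat.sub_add_cancel (Nat.one_le_iff_ne_zero.mpr h)] at h2
    exact h2.symm

/-- `f (∑ j, α_j X_{0 j}, …) ≡ ∑ j, α_j [f]_j` modulo the `X_{i j} ^ q - X_{i j}`. -/
theorem weilComponent_congr (q : ℕ) (hq : 2 ≤ q) (α : Module.Basis (Fin n) k' k)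
    (f : MvPolynomial (Fin m) k) :
    substituted α f - ∑ j, C (α j) * map (algebraMap k' k) (weilComponent q α f j) ∈
      Ideal.span {g : MvPolynomial (Fin m × Fin n) k | ∃ p, g = X p ^ q - X p} := by
  rw [← Ideal.Quotient.eq]
  set I := Ideal.span {g : MvPolynomial (Fin m × Fin n) k | ∃ p, g = X p ^ q - X p}
  have hX : ∀ p, (Ideal.Quotient.mk I (X p)) ^ q = Ideal.Quotient.mk I (X p) := by
    intro p
    rw [← map_pow, Ideal.Quotient.eq]
    exact Ideal.subset_span ⟨p, rfl⟩
  have hmon : ∀ (e : Fin m × Fin n →₀ ℕ) (c : k),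
      Ideal.Quotient.mk I (monomial (e.mapRange (reduceExp q) (reduceExp_zero q)) c) =
        Ideal.Quotient.mk I (monomial e c) := by
    intro e c
    rw [monomial_eq, monomial_eq, Finsupp.prod_fintype _ _ (by simp),
      Finsupp.prod_fintype _ _ (by simp)]
    simp only [map_mul, map_prod, map_pow, Finsupp.mapRange_apply]
    congr 1
    exact Finset.prod_congr rfl fun p _ => pow_reduceExp_congr q hq _ (hX p) _
  have hsum : ∑ j, C (α j) * map (algebraMap k' k) (weilComponent q α f j) =
      ∑ e ∈ (substituted α f).support,
        monomial (e.mapRange (reduceExp q) (reduceExp_zero q)) ((substituted α f).coeff e) := by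
    simp only [weilComponent, map_sum, map_monomial, Finset.mul_sum, C_mul_monomial]
    rw [Finset.sum_comm]
    refine Finset.sum_congr rfl fun e _ => ?_
    rw [← map_sum]
    congr 1
    conv_rhs => rw [← α.sum_repr ((substituted α f).coeff e)]
    refine Finset.sum_congr rfl fun j _ => ?_
    rw [Algebra.smul_def, mul_comm]
  rw [hsum, map_sum]
  conv_lhs => rw [(substituted α f).as_sum, map_sum]
  exact Finset.sum_congr rfl fun e _ => (hmon e _).symm

end Descent

end WeilDescent

end

noncomputable section

namespace WeilDescent

open MvPolynomial

/-! ### The spaces V_{F,i} and degree bookkeeping -/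

section Constructible

variable {σ K : Type*} [Field K] {F : Set (MvPolynomial σ K)} {i j : ℕ∞}

/-! Extending scalars creates no new elements of V (`mem_constructible_of_map_mem`), so the descent
system may be studied over k; call it G there. The linear forms y_{ij} = ∑_l α_l^{q^j} X_{il}
satisfy y_{ij}^q ≡ y_{i,j+1} modulo the field equations, and y_{in} = y_{i0}. The map `twist` sends
X_i^e to the product of the y_{ij}^{d_j}, where the d_j are the base q digits of e, so the degree
drops from e to a digit sum. It fails to be multiplicative only through carries, which lower the
degree; the defect lies in V_{G,B} as soon as B bounds the digit sums of the exponents involved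
(`twist_mul_sub_mem`). Hence `twist` carries V_{F,r} into V_{G,B} (`twist_mem_constructible`), and
concavity of the logarithm yields τ (`sum_digitSum_add_le_max_tau`).

By the Nullstellensatz and Galois descent, I contains h(X_t) and X_i - g_i(X_t) with deg h ≤ s and
deg g_i < s, and h divides every p with p(X_t) in I (`exists_shape`). This makes d_F finite
(`lastFallDegree_ne_top`). Take r ≥ max(d_F, 2s). Then the twists of these relations lie in V_{G,B}.
Write u(p) for the twist of p(X_t). The y_{ij} span the variables and y_{ij} ≡ u(g_i^{q^j} mod h),
so every f of degree at most B is congruent to some u(p) with deg p < s (`exists_sub_map_mem`). If f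
lies in the descent ideal, evaluation at the k-rational zeros of F shows that p vanishes at the
roots of h in k, so p lies in (h, X^{q^n} - X). Periodicity of y_{tj} in j then puts u(p) in V_{G,B}
(`map_mem_of_mem_span`). Large powers are only ever computed modulo h, so q^n never enters as a
degree and the bound is independent of n. -/

theorem subset_constructible {f : MvPolynomial σ K} (hf : f ∈ F)
    (hd : (f.totalDegree : ℕ∞) ≤ i) : f ∈ constructible F i :=
  Submodule.mem_sInf.2 fun _ hW => hW.1 f hf hd

theorem mul_mem_constructible {g : MvPolynomial σ K} (hg : g ∈ constructible F i)
    (h : MvPolynomial σ K) (hd : ((h * g).totalDegree : ℕ∞) ≤ i) : h * g ∈ constructible F i :=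
  Submodule.mem_sInf.2 fun W hW => hW.2 g (Submodule.mem_sInf.1 hg W hW) h hd

theorem constructible_le {W : Submodule K (MvPolynomial σ K)}
    (h1 : ∀ f ∈ F, (f.totalDegree : ℕ∞) ≤ i → f ∈ W)
    (h2 : ∀ g ∈ W, ∀ h : MvPolynomial σ K, ((h * g).totalDegree : ℕ∞) ≤ i → h * g ∈ W) :
    constructible F i ≤ W :=
  sInf_le ⟨h1, h2⟩

theorem constructible_mono (hij : i ≤ j) : constructible F i ≤ constructible F j :=
  constructible_le (fun _ hf hd => subset_constructible hf (hd.trans hij))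
    fun _ hg h hd => mul_mem_constructible hg h (hd.trans hij)

theorem constructible_le_span : constructible F i ≤ (Ideal.span F).restrictScalars K :=
  (constructible_mono le_top).trans (constructible_top F).le

theorem exists_mem_constructible {f : MvPolynomial σ K} (hf : f ∈ Ideal.span F) :
    ∃ N : ℕ, f ∈ constructible F N := by
  induction hf using Submodule.span_induction with
  | mem x hx => exact ⟨x.totalDegree, subset_constructible hx le_rfl⟩
  | zero => exact ⟨0, Submodule.zero_mem _⟩
  | add x y _ _ hx hy =>
    obtain ⟨a, ha⟩ := hx
    obtain ⟨b, hb⟩ := hy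
    refine ⟨max a b, Submodule.add_mem _ (constructible_mono ?_ ha) (constructible_mono ?_ hb)⟩
    · exact_mod_cast le_max_left a b
    · exact_mod_cast le_max_right a b
  | smul a x _ hx =>
    obtain ⟨b, hb⟩ := hx
    refine ⟨max b (a * x).totalDegree, mul_mem_constructible (constructible_mono ?_ hb) a ?_⟩
    · exact_mod_cast le_max_left _ _
    · exact_mod_cast le_max_right _ _

/-- The infimum defining the last fall degree is attained, since ℕ∞ is well-ordered and `⊤` is
admissible. -/
theorem mem_constructible_of_lastFallDegree_le {d : ℕ∞} (hd : lastFallDegree F ≤ d)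
    {f : MvPolynomial σ K} (hf : f ∈ Ideal.span F) (hfd : (f.totalDegree : ℕ∞) ≤ d) :
    f ∈ constructible F d := by
  have h := csInf_mem (s := {d : ℕ∞ | ∀ f ∈ Ideal.span F,
    f ∈ constructible F (max d (f.totalDegree : ℕ∞))})
    ⟨⊤, fun f hf => by rw [max_eq_left le_top, constructible_top]; exact hf⟩
  exact constructible_mono (max_le hd hfd) (h f hf)

theorem mul_mem_restrictTotalDegree {a b : ℕ} {f g : MvPolynomial σ K}
    (hf : f ∈ restrictTotalDegree σ K a) (hg : g ∈ restrictTotalDegree σ K b) :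
    f * g ∈ restrictTotalDegree σ K (a + b) := by
  rw [mem_restrictTotalDegree] at *
  exact (totalDegree_mul f g).trans (add_le_add hf hg)

theorem restrictTotalDegree_mono {a b : ℕ} (h : a ≤ b) :
    restrictTotalDegree σ K a ≤ restrictTotalDegree σ K b := fun f hf => by
  rw [mem_restrictTotalDegree] at *
  exact hf.trans h

theorem X_mem_restrictTotalDegree (p : σ) : X p ∈ restrictTotalDegree σ K 1 := by
  rw [mem_restrictTotalDegree, totalDegree_X]

theorem one_mem_restrictTotalDegree (a : ℕ) : 1 ∈ restrictTotalDegree σ K a := by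
  rw [mem_restrictTotalDegree, totalDegree_one]
  exact Nat.zero_le _

theorem pow_mem_restrictTotalDegree {a : ℕ} {f : MvPolynomial σ K}
    (hf : f ∈ restrictTotalDegree σ K a) (e : ℕ) :
    f ^ e ∈ restrictTotalDegree σ K (e * a) := by
  rw [mem_restrictTotalDegree] at *
  exact (totalDegree_pow f e).trans (Nat.mul_le_mul_left e hf)

theorem prod_mem_restrictTotalDegree {ι : Type*} (s : Finset ι) (d : ι → ℕ)
    (u : ι → MvPolynomial σ K) (hu : ∀ p ∈ s, u p ∈ restrictTotalDegree σ K (d p)) :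
    ∏ p ∈ s, u p ∈ restrictTotalDegree σ K (∑ p ∈ s, d p) := by
  rw [mem_restrictTotalDegree]
  exact (totalDegree_finsetProd s u).trans
    (Finset.sum_le_sum fun p hp => (mem_restrictTotalDegree _ _ _).1 (hu p hp))

/-- The elements of `V_{F,B}` of degree at most `d`. -/
def constructibleUpTo (F : Set (MvPolynomial σ K)) (B d : ℕ) : Submodule K (MvPolynomial σ K) :=
  constructible F B ⊓ restrictTotalDegree σ K d

variable {B d d' : ℕ}

theorem mul_mem_constructibleUpTo {c v : MvPolynomial σ K} (hc : c ∈ restrictTotalDegree σ K d)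
    (hv : v ∈ constructibleUpTo F B d') (hd : d + d' ≤ B) :
    c * v ∈ constructibleUpTo F B (d + d') := by
  have h := mul_mem_restrictTotalDegree hc hv.2
  refine ⟨mul_mem_constructible hv.1 c ?_, h⟩
  rw [mem_restrictTotalDegree] at h
  exact_mod_cast h.trans hd

theorem mul_mem_constructible_of_le {c v : MvPolynomial σ K}
    (hc : c ∈ restrictTotalDegree σ K d) (hv : v ∈ constructible F B)
    (hv' : v ∈ restrictTotalDegree σ K d') (hd : d + d' ≤ B) : c * v ∈ constructible F B :=
  (mul_mem_constructibleUpTo hc ⟨hv, hv'⟩ hd).1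

theorem constructibleUpTo_mono (h : d ≤ d') :
    constructibleUpTo F B d ≤ constructibleUpTo F B d' :=
  inf_le_inf_left _ (restrictTotalDegree_mono h)

/-- Telescoping: factors are exchanged one at a time, each within its own degree allowance `d p`. -/
theorem prod_sub_prod_mem_constructibleUpTo {ι : Type*} (s : Finset ι) (d : ι → ℕ)
    (u v : ι → MvPolynomial σ K) (hu : ∀ p ∈ s, u p ∈ restrictTotalDegree σ K (d p))
    (hv : ∀ p ∈ s, v p ∈ restrictTotalDegree σ K (d p))
    (huv : ∀ p ∈ s, u p - v p ∈ constructibleUpTo F B (d p)) (hB : ∑ p ∈ s, d p ≤ B) :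
    ∏ p ∈ s, u p - ∏ p ∈ s, v p ∈ constructibleUpTo F B (∑ p ∈ s, d p) := by
  classical
  induction s using Finset.induction_on with
  | empty => simp
  | insert a s ha ih =>
    rw [Finset.prod_insert ha, Finset.prod_insert ha]
    rw [Finset.sum_insert ha] at hB ⊢
    have h1 := prod_mem_restrictTotalDegree s d v fun p hp => hv p (Finset.mem_insert_of_mem hp)
    have h2 := ih (fun p hp => hu p (Finset.mem_insert_of_mem hp))
      (fun p hp => hv p (Finset.mem_insert_of_mem hp))
      (fun p hp => huv p (Finset.mem_insert_of_mem hp)) (by omega)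
    have h3 := mul_mem_constructibleUpTo (hu a (Finset.mem_insert_self a s)) h2 hB
    have h4 := mul_mem_constructibleUpTo h1 (huv a (Finset.mem_insert_self a s)) (by omega)
    rw [add_comm] at h4
    convert Submodule.add_mem _ h3 h4 using 1
    ring

/-- If a space `U` of polynomials of degree less than `B` represents `1` and the products of its
elements with the variables modulo `V_{F,B}`, then it represents every polynomial of degree at
most `B`. -/
theorem exists_sub_mem_constructible (U : Submodule K (MvPolynomial σ K))
    (hU : ∀ w ∈ U, w ∈ restrictTotalDegree σ K (B - 1))
    (h1 : ∃ w ∈ U, 1 - w ∈ constructible F B)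
    (hX : ∀ p, ∀ w ∈ U, ∃ w' ∈ U, X p * w - w' ∈ constructible F B)
    (f : MvPolynomial σ K) (hf : f ∈ restrictTotalDegree σ K B) :
    ∃ w ∈ U, f - w ∈ constructible F B := by
  have key : ∀ N : ℕ, N ≤ B → ∀ e : σ →₀ ℕ, e.degree = N →
      ∃ w ∈ U, monomial e 1 - w ∈ constructible F B := by
    intro N
    induction N with
    | zero =>
      intro _ e he
      obtain rfl := (Finsupp.degree_eq_zero_iff e).1 he
      exact h1
    | succ N ih =>
      intro hN e he
      obtain ⟨p, hp⟩ : ∃ p, e p ≠ 0 := by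
        by_contra! h
        obtain rfl : e = 0 := Finsupp.ext h
        simp at he
      have hle : Finsupp.single p 1 ≤ e := by
        rw [Finsupp.single_le_iff]; omega
      obtain ⟨e', rfl⟩ := exists_add_of_le hle
      have he' : e'.degree = N := by
        rw [map_add, Finsupp.degree_single] at he; omega
      obtain ⟨w, hw, hw'⟩ := ih (by omega) e' he'
      obtain ⟨w₂, hw₂, hw₂'⟩ := hX p w hw
      refine ⟨w₂, hw₂, ?_⟩
      -- The slack of one degree below `B` pays for the multiplication by `X p`.
      have hd : monomial e' (1 : K) - w ∈ restrictTotalDegree σ K (B - 1) := by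
        refine Submodule.sub_mem _ ?_ (hU w hw)
        rw [mem_restrictTotalDegree, totalDegree_monomial _ one_ne_zero]
        change e'.degree ≤ _
        omega
      have := mul_mem_constructible_of_le (X_mem_restrictTotalDegree p) hw' hd (by omega)
      convert Submodule.add_mem _ this hw₂' using 1
      rw [show monomial (Finsupp.single p 1 + e') (1 : K) = X p * monomial e' 1 by
        rw [X, monomial_mul, one_mul]]
      ring
  suffices restrictTotalDegree σ K B ≤ U ⊔ constructible F B by
    obtain ⟨w, hw, v, hv, rfl⟩ := Submodule.mem_sup.1 (this hf)
    exact ⟨w, hw, by simpa using hv⟩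
  intro f hf
  rw [mem_restrictTotalDegree] at hf
  rw [f.as_sum]
  refine Submodule.sum_mem _ fun e he => ?_
  obtain ⟨w, hw, hw'⟩ := key e.degree ((le_totalDegree he).trans hf) e rfl
  rw [show monomial e (f.coeff e) = f.coeff e • monomial e (1 : K) by simp [smul_monomial]]
  refine Submodule.smul_mem _ _ ?_
  exact Submodule.mem_sup.2 ⟨w, hw, _, hw', by ring⟩

end Constructible

/-! ### Extension of scalars -/

section BaseChange

variable {σ k' k : Type*} [Field k'] [Field k] [Algebra k' k]

/-- Extending the field of coefficients creates no new elements of `V_{F,i}`. -/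
theorem mem_constructible_of_map_mem (F : Set (MvPolynomial σ k')) (i : ℕ∞)
    {f : MvPolynomial σ k'}
    (hf : map (algebraMap k' k) f ∈ constructible (map (algebraMap k' k) '' F) i) :
    f ∈ constructible F i := by
  -- A linear retraction of k onto k', applied to the coefficients, descends to k' without raising
  -- degrees.
  obtain ⟨φ, hφ⟩ : ∃ φ : k →ₗ[k'] k', φ 1 = 1 := by
    obtain ⟨φ, hφ⟩ := (Algebra.linearMap k' k).exists_leftInverse_of_injective
      (LinearMap.ker_eq_bot.2 (algebraMap k' k).injective)
    exact ⟨φ, by simpa using LinearMap.congr_fun hφ 1⟩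
  let Φ : MvPolynomial σ k →ₗ[k'] MvPolynomial σ k' :=
    (AddMonoidAlgebra.coeffLinearEquiv k').symm.toLinearMap ∘ₗ
      Finsupp.mapRange.linearMap φ ∘ₗ (AddMonoidAlgebra.coeffLinearEquiv k').toLinearMap
  have hΦ : ∀ p e, (Φ p).coeff e = φ (p.coeff e) := fun p e => rfl
  have hdeg : ∀ p, (Φ p).totalDegree ≤ p.totalDegree := by
    intro p
    refine Finset.sup_mono fun e he => ?_
    rw [mem_support_iff] at he ⊢
    intro h
    rw [hΦ, h, map_zero] at he
    exact he rfl
  have hmap : ∀ (c : k) (g : MvPolynomial σ k'),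
      Φ (C c * map (algebraMap k' k) g) = φ c • g := by
    intro c g
    ext e
    rw [hΦ, coeff_C_mul, coeff_map, coeff_smul, mul_comm, ← Algebra.smul_def, map_smul,
      smul_eq_mul, smul_eq_mul, mul_comm]
  have hmon : ∀ (e : σ →₀ ℕ) (c : k) (g : MvPolynomial σ k),
      Φ (monomial e c * g) = monomial e 1 * Φ (C c * g) := by
    intro e c g
    ext a
    rw [hΦ, coeff_monomial_mul', coeff_monomial_mul']
    split_ifs
    · rw [hΦ, coeff_C_mul, one_mul]
    · exact map_zero φ
  -- Quantifying over all scalars `c` makes this a `k`-subspace although `Φ` is only `k'`-linear.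
  let W : Submodule k (MvPolynomial σ k) :=
    { carrier := {g | ∀ c : k, Φ (C c * g) ∈ constructible F i}
      zero_mem' := fun c => by simp
      add_mem' := fun {a b} ha hb c => by
        rw [mul_add, map_add]; exact Submodule.add_mem _ (ha c) (hb c)
      smul_mem' := fun c' g hg c => by
        rw [smul_eq_C_mul, ← mul_assoc, ← C_mul]; exact hg _ }
  have hW : constructible (map (algebraMap k' k) '' F) i ≤ W := by
    refine constructible_le ?_ ?_
    · rintro _ ⟨g, hg, rfl⟩ hd c
      rw [hmap]
      refine Submodule.smul_mem _ _ (subset_constructible hg ?_)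
      have : g.totalDegree = (map (algebraMap k' k) g).totalDegree := by
        unfold totalDegree
        rw [support_map_of_injective g (algebraMap k' k).injective]
      rwa [this]
    · intro g hg h hd c
      rcases eq_or_ne h 0 with rfl | h0
      · simp
      rcases eq_or_ne g 0 with rfl | g0
      · simp
      -- Degrees add exactly, so every monomial of `h` times `g` is within the bound and `h` can be
      -- split into monomials.
      rw [totalDegree_mul_of_isDomain h0 g0] at hd
      rw [h.as_sum, Finset.sum_mul, Finset.mul_sum, map_sum]
      refine Submodule.sum_mem _ fun e he => ?_
      rw [← mul_assoc, C_mul_monomial, hmon]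
      refine mul_mem_constructible (hg _) _ (le_trans ?_ hd)
      norm_cast
      refine (totalDegree_mul _ _).trans (add_le_add ?_ ?_)
      · exact (totalDegree_monomial_le _ _).trans (le_totalDegree he)
      · refine (hdeg _).trans ((totalDegree_mul _ _).trans ?_)
        rw [totalDegree_C, zero_add]
  have := hW hf 1
  rwa [hmap, hφ, one_smul] at this

end BaseChange

/-! ### The shape lemma and finiteness of the last fall degree -/

section Shape

theorem exists_map_eq_of_forall_map_eq {k K : Type*} [Field k] [Field K] [Algebra k K]
    [IsGalois k K] (P : Polynomial K)
    (hP : ∀ σ : K ≃ₐ[k] K, P.map (σ : K →+* K) = P) :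
    ∃ p : Polynomial k, p.map (algebraMap k K) = P := by
  rw [← Polynomial.mem_lifts, Polynomial.lifts_iff_coeff_lifts]
  intro n
  rw [InfiniteGalois.mem_range_algebraMap_iff_fixed]
  intro σ
  conv_rhs => rw [← hP σ]
  rw [Polynomial.coeff_map]
  rfl

/-- The roots of `h` are the `t`-coordinates of the zeros, and `g i` interpolates the `i`-th
coordinate as a function of the `t`-th. The Galois group permutes the zeros, so the coefficients lie
in `k`; the Nullstellensatz for a radical ideal turns vanishing on the zeros into membership. With
no zeros, `h = 1`. -/
theorem exists_shape {k K : Type*} [Field k] [Field K] [Algebra k K] [IsAlgClosed K]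
    [IsGalois k K] {m s : ℕ} (F : Set (MvPolynomial (Fin m) k)) {V : Set (Fin m → K)}
    (hV : V = {x | ∀ f ∈ F, aeval x f = 0}) (hZ : V.encard ≤ (s : ℕ∞))
    (hrad : (Ideal.span F).IsRadical) (t : Fin m)
    (hinj : Set.InjOn (fun x : Fin m → K => x t) V) :
    ∃ (h : Polynomial k) (g : Fin m → Polynomial k), h.Monic ∧ h.natDegree ≤ s ∧
      (∀ i, (g i).degree < s) ∧ Polynomial.aeval (X t) h ∈ Ideal.span F ∧
      (∀ i, X i - Polynomial.aeval (X t) (g i) ∈ Ideal.span F) ∧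
      ∀ p : Polynomial k, Polynomial.aeval (X t) p ∈ Ideal.span F → h ∣ p := by
  classical
  have hfin : V.Finite := Set.finite_of_encard_le_coe hZ
  set Z : Finset (Fin m → K) := hfin.toFinset with hZdef
  have hmemZ : ∀ x, x ∈ Z ↔ x ∈ V := fun x => hfin.mem_toFinset
  have hcard : Z.card ≤ s := by
    rw [hfin.encard_eq_coe_toFinset_card] at hZ
    exact_mod_cast hZ
  have hv : Set.InjOn (fun x : Fin m → K => x t) Z := by
    rw [hZdef, hfin.coe_toFinset]; exact hinj
  have hnull : ∀ f : MvPolynomial (Fin m) k,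
      f ∈ Ideal.span F ↔ ∀ x ∈ Z, aeval x f = 0 := by
    intro f
    have h1 := vanishingIdeal_zeroLocus_eq_radical (K := K) (Ideal.span F)
    rw [hrad.radical, zeroLocus_span] at h1
    conv_lhs => rw [← h1]
    rw [mem_vanishingIdeal_iff]
    exact forall_congr' fun x => by rw [hmemZ, hV]
  have hgal : ∀ (σ : K ≃ₐ[k] K), ∀ x ∈ Z, (fun i => σ (x i)) ∈ Z := by
    intro σ x hx
    rw [hmemZ, hV] at hx ⊢
    intro f hf
    have := hx f hf
    have h2 : aeval (fun i => σ (x i)) f = σ (aeval x f) := by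
      rw [← AlgEquiv.coe_toAlgHom, ← AlgHom.comp_apply, comp_aeval]
    rw [h2, this, map_zero]
  have haev : ∀ (x : Fin m → K) (p : Polynomial k),
      aeval x (Polynomial.aeval (X t : MvPolynomial (Fin m) k) p) =
        (p.map (algebraMap k K)).eval (x t) := by
    intro x p
    rw [Polynomial.eval_map_algebraMap, ← Polynomial.aeval_algHom_apply, aeval_X]
  obtain ⟨h, hh⟩ := exists_map_eq_of_forall_map_eq (k := k)
    (Lagrange.nodal Z fun x => x t) (by
      intro σ
      rw [Lagrange.nodal_eq, Polynomial.map_prod]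
      refine Finset.prod_nbij' (fun x i => σ (x i)) (fun x i => σ.symm (x i))
        (fun x hx => hgal σ x hx) (fun x hx => hgal σ.symm x hx) ?_ ?_ ?_
      · intro x _; simp
      · intro x _; simp
      · intro x _; simp)
  have hG : ∀ i, ∃ p : Polynomial k, p.map (algebraMap k K) =
      Lagrange.interpolate Z (fun x => x t) (fun x => x i) := by
    intro i
    -- Interpolants are unique, so it suffices that the conjugate polynomial has the right values;
    -- at `x` this is `σ` applied to the interpolation at `σ⁻¹ x`.
    refine exists_map_eq_of_forall_map_eq _ fun σ => ?_
    refine Lagrange.eq_interpolate_of_eval_eq (s := Z) (v := fun x => x t) (fun x => x i) hv ?_ ?_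
    · rw [Polynomial.degree_map]
      exact Lagrange.degree_interpolate_lt _ hv
    · intro x hx
      have hx' := hgal σ.symm x hx
      have := Lagrange.eval_interpolate_at_node (fun x => x i) hv hx'
      have h2 := congrArg σ this
      have h3 : x t = (σ : K →+* K) (σ.symm (x t)) := by simp
      rw [h3, Polynomial.eval_map_apply]
      simpa using h2
  choose g hg using hG
  have hmonic : (h.map (algebraMap k K)).Monic := hh ▸ Lagrange.nodal_monic
  refine ⟨h, g, Polynomial.monic_of_injective (algebraMap k K).injective hmonic, ?_, ?_, ?_,
    ?_, ?_⟩
  · rw [← Polynomial.natDegree_map (algebraMap k K), hh, Lagrange.natDegree_nodal]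
    exact hcard
  · intro i
    rw [← Polynomial.degree_map _ (algebraMap k K), hg]
    refine (Lagrange.degree_interpolate_lt _ hv).trans_le ?_
    exact_mod_cast hcard
  · rw [hnull]
    intro x hx
    rw [haev, hh]
    exact Lagrange.eval_nodal_at_node (v := fun x : Fin m → K => x t) hx
  · intro i
    rw [hnull]
    intro x hx
    rw [map_sub, haev, hg, aeval_X, Lagrange.eval_interpolate_at_node _ hv hx, sub_self]
  · intro p hp
    rw [hnull] at hp
    rw [← Polynomial.map_dvd_map' (algebraMap k K), hh, Lagrange.nodal_eq]
    -- Distinct zeros have distinct `t`-coordinates, so the linear factors of `h` are pairwise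
    -- coprime.
    refine Finset.prod_dvd_of_coprime ?_ ?_
    · intro x hx y hy hxy
      exact Polynomial.isCoprime_X_sub_C_of_isUnit_sub
        (sub_ne_zero.2 fun h => hxy (hv hx hy h)).isUnit
    · intro x hx
      rw [Polynomial.dvd_iff_isRoot, Polynomial.IsRoot, ← haev]
      exact hp x hx

theorem aeval_X_mem_restrictTotalDegree {σ K : Type*} [Field K] (t : σ) {p : Polynomial K}
    {d : ℕ} (hp : p.natDegree ≤ d) : Polynomial.aeval (X t) p ∈ restrictTotalDegree σ K d := by
  rw [Polynomial.aeval_eq_sum_range]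
  refine Submodule.sum_mem _ fun e he => Submodule.smul_mem _ _ ?_
  rw [mem_restrictTotalDegree, totalDegree_X_pow]
  rw [Finset.mem_range] at he
  omega

/-- Once the degree admits the finitely many relations given by `h` and the `g i`, every polynomial
reduces to a univariate one of degree less than `s`. -/
theorem lastFallDegree_ne_top {σ K : Type*} [Field K] [Finite σ] {s : ℕ} (hs : 1 ≤ s)
    {F : Set (MvPolynomial σ K)} (t : σ) {h : Polynomial K} {g : σ → Polynomial K}
    (hmonic : h.Monic) (hh : h.natDegree ≤ s) (hg : ∀ i, (g i).degree < s)
    (hmem : Polynomial.aeval (X t) h ∈ Ideal.span F)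
    (hgmem : ∀ i, X i - Polynomial.aeval (X t) (g i) ∈ Ideal.span F)
    (hdvd : ∀ p : Polynomial K, Polynomial.aeval (X t) p ∈ Ideal.span F → h ∣ p) :
    lastFallDegree F ≠ ⊤ := by
  cases nonempty_fintype σ
  have hnat : ∀ p : Polynomial K, p.degree < s → p.natDegree ≤ s - 1 := by
    intro p hp
    by_cases h0 : p = 0
    · simp [h0]
    · have := (Polynomial.natDegree_lt_iff_degree_lt h0).2 hp
      omega
  obtain ⟨N₀, hN₀⟩ := exists_mem_constructible hmem
  choose M hM using fun i => exists_mem_constructible (hgmem i)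
  -- The term `2 * s + 1` makes room for products of two univariate representatives.
  set N := max (max N₀ (Finset.univ.sup M)) (2 * s + 1) with hN
  have hhN : ∀ B : ℕ, N ≤ B → Polynomial.aeval (X t) h ∈ constructible F B := fun B hB =>
    constructible_mono (by exact_mod_cast (by omega : N₀ ≤ B)) hN₀
  have hgN : ∀ B : ℕ, N ≤ B → ∀ i, X i - Polynomial.aeval (X t) (g i) ∈ constructible F B := by
    intro B hB i
    have : M i ≤ Finset.univ.sup M := Finset.le_sup (Finset.mem_univ i)
    exact constructible_mono (by exact_mod_cast (by omega : M i ≤ B)) (hM i)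
  have hmul : ∀ B : ℕ, N ≤ B → ∀ p : Polynomial K, p.natDegree ≤ 2 * s → h ∣ p →
      Polynomial.aeval (X t) p ∈ constructible F B := by
    rintro B hB p hp ⟨c, rfl⟩
    rw [mul_comm, map_mul]
    refine mul_mem_constructible (hhN B hB) _ ?_
    rw [← map_mul, mul_comm]
    have := (mem_restrictTotalDegree _ _ _).1 (aeval_X_mem_restrictTotalDegree t hp)
    exact_mod_cast this.trans (by omega)
  refine ne_top_of_le_ne_top (ENat.natCast_ne_top N) (sInf_le ?_)
  intro f hf
  obtain ⟨B, hB, hNB, hfB⟩ : ∃ B : ℕ, (max (N : ℕ∞) (f.totalDegree : ℕ∞)) = B ∧ N ≤ B ∧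
      f.totalDegree ≤ B :=
    ⟨max N f.totalDegree, rfl, le_max_left _ _, le_max_right _ _⟩
  rw [hB]
  set U := (Polynomial.degreeLT K s).map
    (Polynomial.aeval (X t : MvPolynomial σ K)).toLinearMap with hU
  have hmodlt : ∀ p : Polynomial K, (p %ₘ h).degree < s := fun p =>
    (Polynomial.degree_modByMonic_lt p hmonic).trans_le
      (Polynomial.degree_le_of_natDegree_le hh)
  have hred : ∃ w ∈ U, f - w ∈ constructible F B := by
    refine exists_sub_mem_constructible U ?_ ?_ ?_ f ((mem_restrictTotalDegree _ _ _).2 hfB)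
    · rintro _ ⟨p, hp, rfl⟩
      have := hnat p (Polynomial.mem_degreeLT.1 hp)
      exact aeval_X_mem_restrictTotalDegree t (by omega)
    · refine ⟨1, ⟨1, ?_, by simp⟩, by simp⟩
      refine Polynomial.mem_degreeLT.2 ?_
      rw [Polynomial.degree_one]
      exact_mod_cast hs
    · rintro i _ ⟨p, hp, rfl⟩
      have hpd := hnat p (Polynomial.mem_degreeLT.1 hp)
      refine ⟨_, ⟨g i * p %ₘ h, Polynomial.mem_degreeLT.2 (hmodlt _), rfl⟩, ?_⟩
      have h1 : Polynomial.aeval (X t) p * (X i - Polynomial.aeval (X t) (g i)) ∈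
          constructible F B := by
        refine mul_mem_constructible_of_le (aeval_X_mem_restrictTotalDegree t hpd) (hgN B hNB i)
          (d' := s) ?_ (by omega)
        refine Submodule.sub_mem _
          (restrictTotalDegree_mono hs (X_mem_restrictTotalDegree i))
          (aeval_X_mem_restrictTotalDegree t ?_)
        have := hnat _ (hg i)
        omega
      have h2 := hmul B hNB (g i * p - g i * p %ₘ h) (by
        refine (Polynomial.natDegree_sub_le _ _).trans (max_le ?_ ?_)
        · have := hnat _ (hg i)
          exact Polynomial.natDegree_mul_le.trans (by omega)
        · exact (hnat _ (hmodlt _)).trans (by omega))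
        ⟨g i * p /ₘ h, by rw [Polynomial.modByMonic_eq_sub_mul_div]; ring⟩
      convert Submodule.add_mem _ h1 h2 using 1
      simp only [AlgHom.toLinearMap_apply, map_sub, map_mul]
      ring
  obtain ⟨w, hw, hw'⟩ := hred
  obtain ⟨p, hp, rfl⟩ := hw
  have hp' : Polynomial.aeval (X t) p ∈ Ideal.span F := by
    have := Submodule.sub_mem _ hf (constructible_le_span hw')
    simpa using this
  -- As `h` may have degree less than `s`, the representative `p` need not vanish; it is a multiple
  -- of `h` of small degree.
  have h2 := hmul B hNB p (by
    have := hnat p (Polynomial.mem_degreeLT.1 hp)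
    omega) (hdvd p hp')
  simpa using Submodule.add_mem _ hw' h2

end Shape

/-! ### Digit sums and the function τ -/

section DigitSum

/-- The sum of the base `q` digits. -/
def digitSum (q e : ℕ) : ℕ := (Nat.digits q e).sum

theorem digitSum_zero (q : ℕ) : digitSum q 0 = 0 := by simp [digitSum]

theorem digitSum_eq {q : ℕ} (hq : 2 ≤ q) (e : ℕ) : digitSum q e = e % q + digitSum q (e / q) := by
  rcases Nat.eq_zero_or_pos e with rfl | he
  · simp [digitSum]
  · rw [digitSum, Nat.digits_def' hq he, List.sum_cons, digitSum]

theorem digitSum_add_mul {q : ℕ} (hq : 2 ≤ q) {a : ℕ} (ha : a < q) (e : ℕ) :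
    digitSum q (a + q * e) = a + digitSum q e := by
  rw [digitSum_eq hq, Nat.add_mul_mod_self_left, Nat.mod_eq_of_lt ha,
    Nat.add_mul_div_left _ _ (by omega), Nat.div_eq_of_lt ha, zero_add]

theorem digitSum_le (q e : ℕ) : digitSum q e ≤ e := Nat.digit_sum_le q e

/-- `digitSum q e ≤ (q - 1) log_q (e + 1)`. -/
theorem digitSum_mul_log_le {q : ℕ} (hq : 2 ≤ q) (e : ℕ) :
    (digitSum q e : ℝ) * Real.log q ≤ (q - 1) * Real.log (e + 1) := by
  have hq0 : (0 : ℝ) < q - 1 := by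
    have : (2 : ℝ) ≤ q := by exact_mod_cast hq
    linarith
  induction e using Nat.strong_induction_on with
  | _ e ih =>
    rcases Nat.eq_zero_or_pos e with rfl | he
    · simp [digitSum_zero]
    · have hlt : e / q < e := Nat.div_lt_self he hq
      have ih' := ih _ hlt
      set d := e % q with hd
      set f := e / q with hf
      have hdq : d ≤ q - 1 := by have := Nat.mod_lt e (by omega : 0 < q); omega
      have hdq' : (d : ℝ) ≤ q - 1 := by
        have : ((q - 1 : ℕ) : ℝ) = q - 1 := by push_cast [Nat.cast_sub (by omega : 1 ≤ q)]; ring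
        rw [← this]; exact_mod_cast hdq
      have he' : (e : ℝ) = d + q * f := by exact_mod_cast (Nat.mod_add_div e q).symm
      -- Bernoulli's inequality with exponent d/(q-1) ≤ 1 gives q^{d/(q-1)} ≤ 1 + d.
      have hdlog : (d : ℝ) * Real.log q ≤ (q - 1) * Real.log (d + 1) := by
        have h1 : ((1 : ℝ) + (q - 1)) ^ ((d : ℝ) / (q - 1)) ≤ 1 + (d : ℝ) / (q - 1) * (q - 1) :=
          rpow_one_add_le_one_add_mul_self (by linarith) (by positivity)
            ((div_le_one hq0).2 hdq')
        rw [div_mul_cancel₀ _ hq0.ne', add_sub_cancel] at h1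
        have h2 := Real.log_le_log (by positivity) h1
        rw [Real.log_rpow (by linarith), div_mul_eq_mul_div, div_le_iff₀ hq0] at h2
        rw [add_comm (d : ℝ) 1]
        linarith
      -- Here (d+1)(f+1) ≤ d + qf + 1, because d + 1 ≤ q.
      have hprod : Real.log (d + 1) + Real.log (f + 1) ≤ Real.log (e + 1) := by
        rw [← Real.log_mul (by positivity) (by positivity)]
        refine Real.log_le_log (by positivity) ?_
        have : (0 : ℝ) ≤ f := Nat.cast_nonneg f
        rw [he']
        nlinarith
      rw [digitSum_eq hq]
      push_cast
      nlinarith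

/-- Jensen's inequality for the logarithm, through its tangent line at `r / s.card + 1`. -/
theorem sum_digitSum_mul_log_le {ι : Type*} (s : Finset ι) {q r : ℕ} (hq : 2 ≤ q)
    (hs : s.Nonempty) (e : ι → ℕ) (he : ∑ i ∈ s, e i ≤ r) :
    ((∑ i ∈ s, digitSum q (e i) : ℕ) : ℝ) * Real.log q ≤
      s.card * (q - 1) * Real.log (r / s.card + 1) := by
  have hN : (0 : ℝ) < s.card := by exact_mod_cast hs.card_pos
  have hq' : (2 : ℝ) ≤ q := by exact_mod_cast hq
  set c : ℝ := r / s.card + 1 with hc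
  have hc0 : 0 < c := by positivity
  have hlog : ∀ x : ℝ, 0 < x → Real.log x ≤ x / c - 1 + Real.log c := by
    intro x hx
    have := Real.log_le_sub_one_of_pos (div_pos hx hc0)
    rw [Real.log_div hx.ne' hc0.ne'] at this
    linarith
  have h1 : ∑ i ∈ s, Real.log (e i + 1) ≤ s.card * Real.log c := by
    calc ∑ i ∈ s, Real.log (e i + 1) ≤ ∑ i ∈ s, (((e i : ℝ) + 1) / c - 1 + Real.log c) :=
          Finset.sum_le_sum fun i _ => hlog _ (by positivity)
      _ = (∑ i ∈ s, (e i : ℝ) + s.card) / c - s.card + s.card * Real.log c := by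
          rw [Finset.sum_add_distrib, Finset.sum_sub_distrib, ← Finset.sum_div,
            Finset.sum_add_distrib]
          simp
      _ ≤ s.card * Real.log c := by
          have h2 : ∑ i ∈ s, (e i : ℝ) ≤ r := by exact_mod_cast he
          have h3 : (r : ℝ) + s.card = s.card * c := by rw [hc]; field_simp
          have : (∑ i ∈ s, (e i : ℝ) + s.card) / c ≤ s.card := by
            rw [div_le_iff₀ hc0]; linarith
          linarith
  push_cast
  rw [Finset.sum_mul]
  calc ∑ i ∈ s, (digitSum q (e i) : ℝ) * Real.log q ≤ ∑ i ∈ s, (q - 1) * Real.log (e i + 1) :=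
        Finset.sum_le_sum fun i _ => digitSum_mul_log_le hq _
    _ = (q - 1) * ∑ i ∈ s, Real.log (e i + 1) := by rw [Finset.mul_sum]
    _ ≤ (q - 1) * (s.card * Real.log c) := by
        refine mul_le_mul_of_nonneg_left h1 ?_
        linarith
    _ = _ := by ring

/-- The bound `τ(r,q,m)` on the sum of the digit sums of `2 m` numbers of sum at most `r`, with
`m τ(2s,q,1)` taking over where `r` is small. -/
theorem sum_digitSum_add_le_max_tau {m q r s : ℕ} (hq : 2 ≤ q) (hm : 0 < m) (hr : 1 ≤ r)
    (hs : 1 ≤ s) (a b : Fin m → ℕ) (hab : ∑ i, a i + ∑ i, b i ≤ r) :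
    ∑ i, digitSum q (a i) + ∑ i, digitSum q (b i) ≤
      max (tau r q m) (m * tau (2 * s) q 1) := by
  have hq' : (2 : ℝ) ≤ q := by exact_mod_cast hq
  have hlogq : 0 < Real.log q := Real.log_pos (by linarith)
  rcases le_or_gt (2 * m) r with hmr | hmr
  · refine le_max_of_le_left ?_
    rw [tau, if_neg (by omega)]
    refine Nat.le_floor ?_
    have : NeZero m := ⟨hm.ne'⟩
    have key := sum_digitSum_mul_log_le (ι := Fin m ⊕ Fin m) Finset.univ (r := r) hq
      ⟨Sum.inl 0, Finset.mem_univ _⟩ (Sum.elim a b) (by simpa using hab)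
    simp only [Fintype.sum_sum_type, Sum.elim_inl, Sum.elim_inr, Finset.card_univ,
      Fintype.card_sum, Fintype.card_fin] at key
    have h2m : ((m + m : ℕ) : ℝ) = 2 * m := by push_cast; ring
    rw [h2m] at key
    have hm0 : (0 : ℝ) < m := by exact_mod_cast hm
    have hx : (1 : ℝ) ≤ r / (2 * m) := by
      rw [le_div_iff₀ (by positivity), one_mul]; exact_mod_cast hmr
    -- For x = r/(2m) ≥ 1 one has x + 1 ≤ qx; the factor q becomes the summand 1 after the logarithm
    -- in `tau`.
    have hle : Real.log ((r : ℝ) / (2 * m) + 1) ≤ Real.log (r / (2 * m)) + Real.log q := by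
      rw [← Real.log_mul (by positivity) (by positivity)]
      refine Real.log_le_log (by positivity) ?_
      nlinarith
    rw [Real.logb]
    rw [← mul_le_mul_iff_left₀ hlogq]
    refine key.trans ?_
    have : (Real.log ((r : ℝ) / (2 * m)) / Real.log q + 1) * Real.log q =
        Real.log (r / (2 * m)) + Real.log q := by field_simp
    rw [mul_assoc _ (_ + _), this]
    refine mul_le_mul_of_nonneg_left hle ?_
    have : (0 : ℝ) ≤ q - 1 := by linarith
    positivity
  -- For r < 2m, digit sums are bounded by the numbers themselves, and `tau (2 * s) q 1` is at least
  -- 2.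
  · refine le_max_of_le_right ?_
    have h1 : ∑ i, digitSum q (a i) + ∑ i, digitSum q (b i) ≤ m * 2 := by
      have h2 : ∑ i, digitSum q (a i) ≤ ∑ i, a i := Finset.sum_le_sum fun i _ => digitSum_le q _
      have h3 : ∑ i, digitSum q (b i) ≤ ∑ i, b i := Finset.sum_le_sum fun i _ => digitSum_le q _
      omega
    refine h1.trans (Nat.mul_le_mul_left m ?_)
    rw [tau, if_neg (by omega)]
    refine Nat.le_floor ?_
    have hs' : (1 : ℝ) ≤ s := by exact_mod_cast hs
    have : 0 ≤ Real.logb q (((2 * s : ℕ) : ℝ) / (2 * ((1 : ℕ) : ℝ))) := by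
      refine Real.logb_nonneg (by linarith) ?_
      push_cast
      linarith
    push_cast at this ⊢
    nlinarith

end DigitSum

/-! ### The twist: base q expansion of exponents -/

section Twist

theorem digitSum_succ_le {q : ℕ} (hq : 2 ≤ q) (e : ℕ) :
    digitSum q (e + 1) ≤ digitSum q e + 1 := by
  induction e using Nat.strong_induction_on with
  | _ e ih =>
    have hdiv := Nat.mod_add_div e q
    have hmod := Nat.mod_lt e (by omega : 0 < q)
    rcases lt_or_ge (e % q + 1) q with h | h
    · rw [show e + 1 = (e % q + 1) + q * (e / q) by omega, digitSum_add_mul hq h,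
        digitSum_eq hq e]
      omega
    · have h1 : e + 1 = 0 + q * (e / q + 1) := by rw [mul_add]; omega
      rw [h1, digitSum_add_mul hq (by omega), digitSum_eq hq e]
      have := ih _ (Nat.div_lt_self (Nat.pos_of_ne_zero (by rintro rfl; simp at h; omega)) hq)
      omega

/-- Each carry trades `q` units of one digit for a single unit of the next. -/
theorem digitSum_add_le {q : ℕ} (hq : 2 ≤ q) (a b : ℕ) :
    digitSum q (a + b) ≤ digitSum q a + digitSum q b := by
  induction b using Nat.strong_induction_on generalizing a with
  | _ b ih =>
    rcases Nat.eq_zero_or_pos b with rfl | hb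
    · simp
    have ha' := Nat.mod_add_div a q
    have hb' := Nat.mod_add_div b q
    have ha2 := Nat.mod_lt a (by omega : 0 < q)
    have hb2 := Nat.mod_lt b (by omega : 0 < q)
    have := ih _ (Nat.div_lt_self hb hq) (a / q)
    rw [digitSum_eq hq a, digitSum_eq hq b]
    rcases lt_or_ge (a % q + b % q) q with h | h
    · rw [show a + b = (a % q + b % q) + q * (a / q + b / q) by rw [mul_add]; omega,
        digitSum_add_mul hq h]
      omega
    · rw [show a + b = (a % q + b % q - q) + q * (a / q + b / q + 1) by
        rw [mul_add, mul_add]; omega, digitSum_add_mul hq (by omega)]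
      have := digitSum_succ_le hq (a / q + b / q)
      omega

/-- `∏ j, y_j ^ d_j` for a list of exponents `d`. -/
def listPow {A : Type*} [CommRing A] : (ℕ → A) → List ℕ → A
  | _, [] => 1
  | y, d :: ds => y 0 ^ d * listPow (fun j => y (j + 1)) ds

/-- `∏ j, y_j ^ d_j` where `e = ∑ j, d_j q ^ j` is the base `q` expansion of `e`. -/
def digitMonomial {A : Type*} [CommRing A] (q : ℕ) (y : ℕ → A) (e : ℕ) : A :=
  listPow y (Nat.digits q e)

section CommRing

variable {A : Type*} [CommRing A] {q : ℕ}

theorem digitMonomial_zero (y : ℕ → A) : digitMonomial q y 0 = 1 := by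
  simp [digitMonomial, listPow]

theorem digitMonomial_eq (hq : 2 ≤ q) (y : ℕ → A) (e : ℕ) :
    digitMonomial q y e = y 0 ^ (e % q) * digitMonomial q (fun j => y (j + 1)) (e / q) := by
  rcases Nat.eq_zero_or_pos e with rfl | he
  · simp [digitMonomial_zero]
  · rw [digitMonomial, Nat.digits_def' hq he, listPow, digitMonomial]

theorem digitMonomial_add_mul (hq : 2 ≤ q) (y : ℕ → A) {a : ℕ} (ha : a < q) (e : ℕ) :
    digitMonomial q y (a + q * e) = y 0 ^ a * digitMonomial q (fun j => y (j + 1)) e := by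
  rw [digitMonomial_eq hq, Nat.add_mul_mod_self_left, Nat.mod_eq_of_lt ha,
    Nat.add_mul_div_left _ _ (by omega), Nat.div_eq_of_lt ha, zero_add]

theorem digitMonomial_one (hq : 2 ≤ q) (y : ℕ → A) : digitMonomial q y 1 = y 0 := by
  have := digitMonomial_add_mul hq y (show 1 < q by omega) 0
  simpa [digitMonomial_zero] using this

theorem digitMonomial_eq_pow (hq : 2 ≤ q) {y : ℕ → A} (hy : ∀ j, y j ^ q = y (j + 1)) (e : ℕ) :
    digitMonomial q y e = y 0 ^ e := by
  induction e using Nat.strong_induction_on generalizing y with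
  | _ e ih =>
    rcases Nat.eq_zero_or_pos e with rfl | he
    · simp [digitMonomial_zero]
    rw [digitMonomial_eq hq, ih _ (Nat.div_lt_self he hq) fun j => hy (j + 1), ← hy, ← pow_mul,
      ← pow_add, Nat.mod_add_div]

theorem map_digitMonomial {A' : Type*} [CommRing A'] (φ : A →+* A') (hq : 2 ≤ q) (y : ℕ → A)
    (e : ℕ) : φ (digitMonomial q y e) = digitMonomial q (fun j => φ (y j)) e := by
  induction e using Nat.strong_induction_on generalizing y with
  | _ e ih =>
    rcases Nat.eq_zero_or_pos e with rfl | he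
    · simp [digitMonomial_zero]
    rw [digitMonomial_eq hq, digitMonomial_eq hq (fun j => φ (y j)), map_mul, map_pow,
      ih _ (Nat.div_lt_self he hq)]

end CommRing

variable {σ ι K : Type*} [Field K] {G : Set (MvPolynomial σ K)} {q B : ℕ}

theorem digitMonomial_mem_restrictTotalDegree (hq : 2 ≤ q) {y : ℕ → MvPolynomial σ K}
    (hy : ∀ j, y j ∈ restrictTotalDegree σ K 1) (e : ℕ) :
    digitMonomial q y e ∈ restrictTotalDegree σ K (digitSum q e) := by
  induction e using Nat.strong_induction_on generalizing y with
  | _ e ih =>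
    rcases Nat.eq_zero_or_pos e with rfl | he
    · rw [digitMonomial_zero]
      exact one_mem_restrictTotalDegree _
    rw [digitMonomial_eq hq, digitSum_eq hq]
    refine mul_mem_restrictTotalDegree ?_ (ih _ (Nat.div_lt_self he hq) fun j => hy (j + 1))
    simpa using pow_mem_restrictTotalDegree (hy 0) (e % q)

/-- Incrementing an exponent: a carry is the relation y_0^q ≡ y_1, after which the shifted sequence
is incremented. -/
theorem mul_digitMonomial_sub_mem (hq : 2 ≤ q) {y : ℕ → MvPolynomial σ K}
    (hy : ∀ j, y j ∈ restrictTotalDegree σ K 1)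
    (hyq : ∀ j, y j ^ q - y (j + 1) ∈ constructibleUpTo G B q) (e : ℕ)
    (he : 1 + digitSum q e ≤ B) :
    y 0 * digitMonomial q y e - digitMonomial q y (e + 1) ∈
      constructibleUpTo G B (1 + digitSum q e) := by
  induction e using Nat.strong_induction_on generalizing y with
  | _ e ih =>
    have hdiv := Nat.mod_add_div e q
    have hmod := Nat.mod_lt e (by omega : 0 < q)
    rcases lt_or_ge (e % q + 1) q with h | h
    · rw [show e + 1 = (e % q + 1) + q * (e / q) by omega, digitMonomial_add_mul hq y h,
        digitMonomial_eq hq y e, ← mul_assoc, ← pow_succ', sub_self]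
      exact Submodule.zero_mem _
    · have h1 : e + 1 = 0 + q * (e / q + 1) := by rw [mul_add]; omega
      have he' := digitSum_eq hq e
      have hpos : 0 < e := Nat.pos_of_ne_zero (by rintro rfl; simp at h; omega)
      rw [h1, digitMonomial_add_mul hq y (by omega), digitMonomial_eq hq y e]
      have h2 := ih _ (Nat.div_lt_self hpos hq) (fun j => hy (j + 1)) (fun j => hyq (j + 1))
        (by omega)
      have h3 := mul_mem_constructibleUpTo
        (digitMonomial_mem_restrictTotalDegree hq (fun j => hy (j + 1)) (e / q)) (hyq 0)
        (by omega)
      convert Submodule.add_mem _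
        (constructibleUpTo_mono (show _ ≤ 1 + digitSum q e by omega) h2)
        (constructibleUpTo_mono (show _ ≤ 1 + digitSum q e by omega) h3) using 1
      rw [show q = e % q + 1 by omega, pow_succ', ← show q = e % q + 1 by omega]
      ring

theorem digitMonomial_mul_sub_mem (hq : 2 ≤ q) {y : ℕ → MvPolynomial σ K}
    (hy : ∀ j, y j ∈ restrictTotalDegree σ K 1)
    (hyq : ∀ j, y j ^ q - y (j + 1) ∈ constructibleUpTo G B q) (a b : ℕ)
    (hab : digitSum q a + digitSum q b ≤ B) :
    digitMonomial q y a * digitMonomial q y b - digitMonomial q y (a + b) ∈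
      constructibleUpTo G B (digitSum q a + digitSum q b) := by
  induction b using Nat.strong_induction_on generalizing a y with
  | _ b ih =>
    rcases Nat.eq_zero_or_pos b with rfl | hb
    · simp [digitMonomial_zero]
    have ha' := Nat.mod_add_div a q
    have hb' := Nat.mod_add_div b q
    have ha2 := Nat.mod_lt a (by omega : 0 < q)
    have hb2 := Nat.mod_lt b (by omega : 0 < q)
    have hda := digitSum_eq hq a
    have hdb := digitSum_eq hq b
    have hy' : ∀ j, y (j + 1) ∈ restrictTotalDegree σ K 1 := fun j => hy (j + 1)
    have h1 := ih _ (Nat.div_lt_self hb hq) hy' (fun j => hyq (j + 1)) (a / q) (by omega)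
    have hpow : ∀ u, y 0 ^ u ∈ restrictTotalDegree σ K u := fun u => by
      simpa using pow_mem_restrictTotalDegree (hy 0) u
    have h2 := mul_mem_constructibleUpTo (hpow (a % q + b % q)) h1 (by omega)
    rw [digitMonomial_eq hq y a, digitMonomial_eq hq y b]
    rcases lt_or_ge (a % q + b % q) q with h | h
    · rw [show a + b = (a % q + b % q) + q * (a / q + b / q) by rw [mul_add]; omega,
        digitMonomial_add_mul hq y h]
      convert constructibleUpTo_mono (show _ ≤ digitSum q a + digitSum q b by omega) h2 using 1
      rw [pow_add]
      ring
    -- Carry: the higher digits are added (`h2`), `y 0 ^ q` becomes `y 1` (`h5`), and `y 1` is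
    -- absorbed as an increment of the higher digits (`h4`).
    · obtain ⟨v, hv⟩ := exists_add_of_le h
      have hsub := digitSum_add_le hq (a / q) (b / q)
      rw [show a + b = v + q * (a / q + b / q + 1) by rw [mul_add, mul_add]; omega,
        digitMonomial_add_mul hq y (by omega)]
      have h3 := mul_digitMonomial_sub_mem hq hy' (fun j => hyq (j + 1)) (a / q + b / q)
        (by omega)
      have h4 := mul_mem_constructibleUpTo (hpow v) h3 (by omega)
      have h5 := mul_mem_constructibleUpTo (mul_mem_restrictTotalDegree (hpow v)
        (digitMonomial_mem_restrictTotalDegree hq hy' (a / q + b / q))) (hyq 0) (by omega)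
      have hp : y 0 ^ (a % q) * y 0 ^ (b % q) = y 0 ^ q * y 0 ^ v := by
        rw [← pow_add, hv, pow_add]
      convert Submodule.add_mem _
        (constructibleUpTo_mono (show _ ≤ digitSum q a + digitSum q b by omega) h2)
        (Submodule.add_mem _
          (constructibleUpTo_mono (show _ ≤ digitSum q a + digitSum q b by omega) h4)
          (constructibleUpTo_mono (show _ ≤ digitSum q a + digitSum q b by omega) h5)) using 1
      rw [pow_add]
      linear_combination digitMonomial q (fun j => y (j + 1)) (a / q + b / q) * hp

variable [Fintype ι]

/-- The linear map that sends `∏ i, X_i ^ e_i` to `∏ i j, y_{i j} ^ d_{i j}` where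
`e_i = ∑ j, d_{i j} q ^ j` in base `q`. -/
def twist (q : ℕ) (y : ι → ℕ → MvPolynomial σ K) : MvPolynomial ι K →ₗ[K] MvPolynomial σ K :=
  (basisMonomials ι K).constr K fun e => ∏ i, digitMonomial q (y i) (e i)

variable {y : ι → ℕ → MvPolynomial σ K}

theorem twist_monomial (e : ι →₀ ℕ) (c : K) :
    twist q y (monomial e c) = c • ∏ i, digitMonomial q (y i) (e i) := by
  rw [show monomial e c = c • basisMonomials ι K e by simp [smul_monomial], map_smul, twist,
    Module.Basis.constr_basis]

theorem twist_X (hq : 2 ≤ q) (i : ι) : twist q y (X i) = y i 0 := by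
  classical
  rw [X, twist_monomial, one_smul, Finset.prod_eq_single i]
  · rw [Finsupp.single_eq_same, digitMonomial_one hq]
  · intro j _ hj
    rw [Finsupp.single_eq_of_ne hj, digitMonomial_zero]
  · simp

theorem twist_apply (f : MvPolynomial ι K) :
    twist q y f = ∑ e ∈ f.support, f.coeff e • ∏ i, digitMonomial q (y i) (e i) := by
  conv_lhs => rw [f.as_sum, map_sum]
  exact Finset.sum_congr rfl fun e _ => twist_monomial e _

theorem sum_le_totalDegree {f : MvPolynomial ι K} {e : ι →₀ ℕ} (he : e ∈ f.support) :
    ∑ i, e i ≤ f.totalDegree := by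
  rw [← Finsupp.degree_eq_sum]
  exact le_totalDegree he

theorem prod_digitMonomial_mem (hq : 2 ≤ q) (hy : ∀ i j, y i j ∈ restrictTotalDegree σ K 1)
    (e : ι → ℕ) : ∏ i, digitMonomial q (y i) (e i) ∈
      restrictTotalDegree σ K (∑ i, digitSum q (e i)) :=
  prod_mem_restrictTotalDegree _ _ _ fun i _ => digitMonomial_mem_restrictTotalDegree hq (hy i) _

theorem twist_mem_restrictTotalDegree (hq : 2 ≤ q)
    (hy : ∀ i j, y i j ∈ restrictTotalDegree σ K 1) {f : MvPolynomial ι K} {c : ℕ}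
    (hc : ∀ e : ι → ℕ, ∑ i, e i ≤ f.totalDegree → ∑ i, digitSum q (e i) ≤ c) :
    twist q y f ∈ restrictTotalDegree σ K c := by
  rw [twist_apply]
  exact Submodule.sum_mem _ fun e he => Submodule.smul_mem _ _ <|
    restrictTotalDegree_mono (hc e (sum_le_totalDegree he)) (prod_digitMonomial_mem hq hy e)

/-- By bilinearity this concerns two monomials, where it is addition with carries in each variable.
The condition `hr` bounds the degree of the product of their twists. -/
theorem twist_mul_sub_mem (hq : 2 ≤ q) (hy : ∀ i j, y i j ∈ restrictTotalDegree σ K 1)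
    (hyq : ∀ i j, y i j ^ q - y i (j + 1) ∈ constructibleUpTo G B q) {r : ℕ}
    (hr : ∀ a b : ι → ℕ, ∑ i, a i + ∑ i, b i ≤ r →
      ∑ i, digitSum q (a i) + ∑ i, digitSum q (b i) ≤ B)
    {f g : MvPolynomial ι K} (hfg : f.totalDegree + g.totalDegree ≤ r) :
    twist q y f * twist q y g - twist q y (f * g) ∈ constructible G B := by
  have key : twist q y f * twist q y g - twist q y (f * g) =
      ∑ a ∈ f.support, ∑ b ∈ g.support, (f.coeff a * g.coeff b) •
        (∏ i, (digitMonomial q (y i) (a i) * digitMonomial q (y i) (b i)) -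
          ∏ i, digitMonomial q (y i) (a i + b i)) := by
    have h1 : twist q y (f * g) = ∑ a ∈ f.support, ∑ b ∈ g.support,
        (f.coeff a * g.coeff b) • ∏ i, digitMonomial q (y i) (a i + b i) := by
      conv_lhs => rw [f.as_sum, g.as_sum, Finset.sum_mul_sum, map_sum]
      refine Finset.sum_congr rfl fun a _ => ?_
      rw [map_sum]
      refine Finset.sum_congr rfl fun b _ => ?_
      rw [monomial_mul, twist_monomial]
      rfl
    rw [h1, twist_apply, twist_apply, Finset.sum_mul_sum, ← Finset.sum_sub_distrib]
    refine Finset.sum_congr rfl fun a _ => ?_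
    rw [← Finset.sum_sub_distrib]
    refine Finset.sum_congr rfl fun b _ => ?_
    rw [smul_mul_smul_comm, smul_sub, Finset.prod_mul_distrib]
  rw [key]
  refine Submodule.sum_mem _ fun a ha => Submodule.sum_mem _ fun b hb => Submodule.smul_mem _ _ ?_
  have hab := hr a b ((add_le_add (sum_le_totalDegree ha) (sum_le_totalDegree hb)).trans hfg)
  rw [← Finset.sum_add_distrib] at hab
  have hle : ∀ i, digitSum q (a i) + digitSum q (b i) ≤ B := fun i =>
    (Finset.single_le_sum (f := fun i => digitSum q (a i) + digitSum q (b i))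
      (fun _ _ => Nat.zero_le _) (Finset.mem_univ i)).trans hab
  refine (prod_sub_prod_mem_constructibleUpTo (F := G) (B := B) Finset.univ
    (fun i => digitSum q (a i) + digitSum q (b i)) _ _ ?_ ?_ ?_ hab).1
  · intro i _
    exact mul_mem_restrictTotalDegree (digitMonomial_mem_restrictTotalDegree hq (hy i) _)
      (digitMonomial_mem_restrictTotalDegree hq (hy i) _)
  · intro i _
    exact restrictTotalDegree_mono (digitSum_add_le hq _ _)
      (digitMonomial_mem_restrictTotalDegree hq (hy i) _)
  · intro i _
    exact digitMonomial_mul_sub_mem hq (hy i) (hyq i) _ _ (hle i)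

theorem twist_mem_constructible (hq : 2 ≤ q) (hy : ∀ i j, y i j ∈ restrictTotalDegree σ K 1)
    (hyq : ∀ i j, y i j ^ q - y i (j + 1) ∈ constructibleUpTo G B q) {r : ℕ}
    (hr : ∀ a b : ι → ℕ, ∑ i, a i + ∑ i, b i ≤ r →
      ∑ i, digitSum q (a i) + ∑ i, digitSum q (b i) ≤ B)
    {F : Set (MvPolynomial ι K)}
    (hF : ∀ f ∈ F, f.totalDegree ≤ r → twist q y f ∈ constructible G B)
    {f : MvPolynomial ι K} (hf : f ∈ constructible F r) : twist q y f ∈ constructible G B := by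
  suffices constructible F r ≤ (constructible G B).comap (twist q y) from this hf
  refine constructible_le (fun f hf hd => hF f hf (by exact_mod_cast hd)) ?_
  intro g hg h hd
  rcases eq_or_ne h 0 with rfl | h0
  · simp
  rcases eq_or_ne g 0 with rfl | g0
  · simp
  rw [totalDegree_mul_of_isDomain h0 g0] at hd
  have hd : h.totalDegree + g.totalDegree ≤ r := by exact_mod_cast hd
  have h1 := twist_mul_sub_mem hq hy hyq hr hd
  have h2 : twist q y h * twist q y g ∈ constructible G B := by
    rw [twist_apply h, Finset.sum_mul]
    refine Submodule.sum_mem _ fun e he => ?_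
    rw [smul_mul_assoc]
    refine Submodule.smul_mem _ _ ?_
    have he' := sum_le_totalDegree he
    have h3 := hr e 0 (by simp only [Pi.zero_apply, Finset.sum_const_zero]; omega)
    -- Applied to `e` and any exponent vector `a` of `g`, `hr` bounds the degree of the twist of `g`
    -- by what `e` leaves of `B`.
    refine mul_mem_constructible_of_le (prod_digitMonomial_mem hq hy e) hg
      (d' := B - ∑ i, digitSum q (e i)) (twist_mem_restrictTotalDegree hq hy fun a ha => ?_) ?_
    · have := hr e a (by omega)
      omega
    · omega
  have := Submodule.sub_mem _ h2 h1
  rwa [sub_sub_cancel] at this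

end Twist

/-! ### Univariate representatives modulo V_{G,B} -/

section Univariate

theorem dvd_sub_modByMonic {K : Type*} [Field K] (p h : Polynomial K) : h ∣ p - p %ₘ h :=
  ⟨p /ₘ h, by rw [Polynomial.modByMonic_eq_sub_mul_div]; ring⟩

theorem mul_modByMonic_eq {K : Type*} [Field K] {h : Polynomial K} (hmonic : h.Monic)
    (p p' : Polynomial K) : (p %ₘ h) * p' %ₘ h = p * p' %ₘ h := by
  rw [← sub_eq_zero, ← Polynomial.sub_modByMonic, Polynomial.modByMonic_eq_zero_iff_dvd hmonic,
    ← sub_mul, ← neg_sub, neg_mul]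
  exact (dvd_neg.2 ((dvd_sub_modByMonic p h).mul_right p'))

theorem pow_modByMonic_eq {K : Type*} [Field K] {h : Polynomial K} (hmonic : h.Monic)
    (p : Polynomial K) (e : ℕ) : (p %ₘ h) ^ e %ₘ h = p ^ e %ₘ h := by
  rw [← sub_eq_zero, ← Polynomial.sub_modByMonic, Polynomial.modByMonic_eq_zero_iff_dvd hmonic]
  refine dvd_trans ?_ (sub_dvd_pow_sub_pow _ _ e)
  rw [← neg_sub]
  exact dvd_neg.2 (dvd_sub_modByMonic p h)

theorem natDegree_le_of_degree_lt {K : Type*} [Field K] {p : Polynomial K} {s : ℕ}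
    (hp : p.degree < s) : p.natDegree ≤ s - 1 := by
  by_cases h0 : p = 0
  · simp [h0]
  · have := (Polynomial.natDegree_lt_iff_degree_lt h0).2 hp
    omega

/-- Representation of polynomials modulo `V_{G,B}` by univariate polynomials of degree less than
`s`, multiplied modulo `h`. -/
structure UnivariateModel {σ K : Type*} [Field K] (G : Set (MvPolynomial σ K)) (B s : ℕ)
    (h : Polynomial K) (u : Polynomial K →ₗ[K] MvPolynomial σ K) : Prop where
  two_le : 2 ≤ B
  monic : h.Monic
  natDegree_le : h.natDegree ≤ s
  map_one : u 1 = 1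
  map_mem : ∀ p : Polynomial K, p.degree < s → u p ∈ restrictTotalDegree σ K (B / 2)
  mul_mem : ∀ p p' : Polynomial K, p.degree < s → p'.degree < s →
    u p * u p' - u (p * p') ∈ constructible G B
  dvd_mem : ∀ p : Polynomial K, h ∣ p → p.natDegree ≤ 2 * s → u p ∈ constructible G B

namespace UnivariateModel

variable {σ K : Type*} [Field K] {G : Set (MvPolynomial σ K)} {B s : ℕ}
  {h : Polynomial K} {u : Polynomial K →ₗ[K] MvPolynomial σ K}

theorem degree_mod_lt (M : UnivariateModel G B s h u) (p : Polynomial K) : (p %ₘ h).degree < s :=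
  (Polynomial.degree_modByMonic_lt p M.monic).trans_le
    (Polynomial.degree_le_of_natDegree_le M.natDegree_le)

theorem sub_mod_mem (M : UnivariateModel G B s h u) (p : Polynomial K) (hp : p.natDegree ≤ 2 * s) :
    u p - u (p %ₘ h) ∈ constructible G B := by
  rw [← map_sub]
  refine M.dvd_mem _ (dvd_sub_modByMonic p h) ((Polynomial.natDegree_sub_le _ _).trans
    (max_le hp ?_))
  have := natDegree_le_of_degree_lt (M.degree_mod_lt p)
  omega

theorem mul_mod_mem (M : UnivariateModel G B s h u)
    {p p' : Polynomial K} (hp : p.degree < s) (hp' : p'.degree < s) :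
    u p * u p' - u (p * p' %ₘ h) ∈ constructible G B := by
  have h1 := M.sub_mod_mem (p * p') (by
    have := natDegree_le_of_degree_lt hp
    have := natDegree_le_of_degree_lt hp'
    exact Polynomial.natDegree_mul_le.trans (by omega))
  simpa using Submodule.add_mem _ (M.mul_mem p p' hp hp') h1

/-- Multiplication by a linear form. -/
theorem linear_mul_mem (M : UnivariateModel G B s h u)
    {v w : MvPolynomial σ K} {p p' : Polynomial K}
    (hv : v ∈ restrictTotalDegree σ K 1) (hw : w ∈ restrictTotalDegree σ K (B - 1))
    (hp : p.degree < s) (hp' : p'.degree < s) (hvp : v - u p ∈ constructible G B)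
    (hwp : w - u p' ∈ constructible G B) : v * w - u (p * p' %ₘ h) ∈ constructible G B := by
  have hB := M.two_le
  have h1 := mul_mem_constructible_of_le hv hwp (d' := B - 1) (Submodule.sub_mem _ hw
    (restrictTotalDegree_mono (by omega) (M.map_mem p' hp'))) (by omega)
  have h2 := mul_mem_constructible_of_le (M.map_mem p' hp') hvp (d' := B / 2)
    (Submodule.sub_mem _ (restrictTotalDegree_mono (by omega) hv) (M.map_mem p hp)) (by omega)
  convert Submodule.add_mem _ (Submodule.add_mem _ h1 h2) (M.mul_mod_mem hp hp') using 1
  ring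

theorem linear_pow_mem (M : UnivariateModel G B s h u)
    {v : MvPolynomial σ K} {p : Polynomial K}
    (hv : v ∈ restrictTotalDegree σ K 1) (hp : p.degree < s) (hvp : v - u p ∈ constructible G B)
    (e : ℕ) (he : e ≤ B) : v ^ e - u (p ^ e %ₘ h) ∈ constructible G B := by
  induction e with
  | zero =>
    have := M.sub_mod_mem 1 (by simp)
    rwa [M.map_one] at this
  | succ e ih =>
    have h1 := M.linear_mul_mem hv (w := v ^ e) (restrictTotalDegree_mono (by omega)
      (pow_mem_restrictTotalDegree hv e)) hp (M.degree_mod_lt _) hvp (ih (by omega))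
    rwa [mul_comm p, mul_modByMonic_eq M.monic, ← pow_succ, ← pow_succ'] at h1

variable {q : ℕ}

/-- Each form is the `q`-th power of the preceding one; reducing modulo `h` at every stage keeps the
required degree at `q` instead of `q ^ j`. -/
theorem frobenius_mem (M : UnivariateModel G B s h u)
    {y : ℕ → MvPolynomial σ K} (hqB : q ≤ B)
    (hy : ∀ j, y j ∈ restrictTotalDegree σ K 1)
    (hyq : ∀ j, y j ^ q - y (j + 1) ∈ constructible G B) {g : Polynomial K} (hg : g.degree < s)
    (hyg : y 0 - u g ∈ constructible G B) (j : ℕ) :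
    y j - u (g ^ q ^ j %ₘ h) ∈ constructible G B := by
  induction j with
  | zero =>
    have := M.sub_mod_mem g ((natDegree_le_of_degree_lt hg).trans (by omega))
    simpa using Submodule.add_mem _ hyg this
  | succ j ih =>
    have h1 := M.linear_pow_mem (hy j) (M.degree_mod_lt _) ih q hqB
    rw [pow_modByMonic_eq M.monic, ← pow_mul, ← pow_succ] at h1
    simpa using Submodule.sub_mem _ h1 (hyq j)

/-- If the linear forms `y_j` are periodic then the ideal `(h, X ^ q ^ n - X)` is represented by
elements of `V_{G,B}`. -/
theorem map_mem_of_mem_span (M : UnivariateModel G B s h u)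
    {y : ℕ → MvPolynomial σ K} (hqB : q ≤ B)
    (hy : ∀ j, y j ∈ restrictTotalDegree σ K 1)
    (hyq : ∀ j, y j ^ q - y (j + 1) ∈ constructible G B) {g : Polynomial K} (hg : g.degree < s)
    (hyg : y 0 - u g ∈ constructible G B) {n : ℕ} (hn : y n = y 0) (hX : h ∣ Polynomial.X - g)
    {p a c : Polynomial K} (hp : p.degree < s)
    (hpac : p = a * h + c * (Polynomial.X ^ q ^ n - Polynomial.X)) : u p ∈ constructible G B := by
  set w := (Polynomial.X ^ q ^ n - Polynomial.X) %ₘ h with hw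
  -- Since X ≡ g modulo `h`, `w` is the difference of the residues of g^{q^n} and g, which represent
  -- the same form `y n = y 0`.
  have hwmem : u w ∈ constructible G B := by
    have h0 := M.frobenius_mem hqB hy hyq hg hyg 0
    have h1 := M.frobenius_mem hqB hy hyq hg hyg n
    have h2 : w = g ^ q ^ n %ₘ h - g ^ q ^ 0 %ₘ h := by
      rw [hw, ← Polynomial.sub_modByMonic, ← sub_eq_zero, ← Polynomial.sub_modByMonic,
        Polynomial.modByMonic_eq_zero_iff_dvd M.monic]
      have h3 : h ∣ Polynomial.X ^ q ^ n - g ^ q ^ n := hX.trans (sub_dvd_pow_sub_pow _ _ _)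
      convert dvd_sub h3 hX using 1
      ring
    rw [h2, map_sub]
    rw [hn] at h1
    simpa using Submodule.sub_mem _ h0 h1
  have hc := M.degree_mod_lt c
  have hw' : w.degree < s := M.degree_mod_lt _
  have h1 : u (c %ₘ h) * u w ∈ constructible G B :=
    mul_mem_constructible_of_le (M.map_mem _ hc) hwmem (M.map_mem _ hw') (by omega)
  have h2 := Submodule.sub_mem _ h1 (M.mul_mod_mem hc hw')
  rw [sub_sub_cancel] at h2
  -- Only residues modulo `h` matter, so the degrees of `a` and `c` may be arbitrary.
  have h3 : p %ₘ h = (c %ₘ h) * w %ₘ h := by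
    rw [mul_modByMonic_eq M.monic, mul_comm, mul_modByMonic_eq M.monic, ← sub_eq_zero,
      ← Polynomial.sub_modByMonic, Polynomial.modByMonic_eq_zero_iff_dvd M.monic, hpac]
    exact ⟨a, by ring⟩
  have h4 := M.sub_mod_mem p ((natDegree_le_of_degree_lt hp).trans (by omega))
  rw [h3] at h4
  simpa using Submodule.add_mem _ h4 h2

theorem exists_sub_map_mem (M : UnivariateModel G B s h u)
    {ι : Type*} {y : ι → ℕ → MvPolynomial σ K} (hqB : q ≤ B)
    (hy : ∀ i j, y i j ∈ restrictTotalDegree σ K 1)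
    (hyq : ∀ i j, y i j ^ q - y i (j + 1) ∈ constructible G B) {g : ι → Polynomial K}
    (hg : ∀ i, (g i).degree < s) (hyg : ∀ i, y i 0 - u (g i) ∈ constructible G B)
    (hspan : ∀ x, X x ∈ Submodule.span K {v | ∃ i j, v = y i j}) {f : MvPolynomial σ K}
    (hf : f ∈ restrictTotalDegree σ K B) :
    ∃ p : Polynomial K, p.degree < s ∧ f - u p ∈ constructible G B := by
  have hB := M.two_le
  set U := (Polynomial.degreeLT K s).map u
  have hlin : ∀ x, ∃ p : Polynomial K, p.degree < s ∧ X x - u p ∈ constructible G B := by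
    have hle : Submodule.span K {v | ∃ i j, v = y i j} ≤ U ⊔ constructible G B := by
      rw [Submodule.span_le]
      rintro _ ⟨i, j, rfl⟩
      exact Submodule.mem_sup.2 ⟨_, ⟨_, Polynomial.mem_degreeLT.2 (M.degree_mod_lt _), rfl⟩, _,
        M.frobenius_mem hqB (hy i) (hyq i) (hg i) (hyg i) j, by ring⟩
    intro x
    obtain ⟨_, ⟨p, hp, rfl⟩, v, hv, hx⟩ := Submodule.mem_sup.1 (hle (hspan x))
    refine ⟨p, Polynomial.mem_degreeLT.1 hp, ?_⟩
    rwa [← hx, add_sub_cancel_left]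
  have hred : ∃ w ∈ U, f - w ∈ constructible G B := by
    refine exists_sub_mem_constructible U ?_ ?_ ?_ f hf
    · rintro _ ⟨p, hp, rfl⟩
      exact restrictTotalDegree_mono (by omega) (M.map_mem p (Polynomial.mem_degreeLT.1 hp))
    · refine ⟨_, ⟨1 %ₘ h, Polynomial.mem_degreeLT.2 (M.degree_mod_lt _), rfl⟩, ?_⟩
      have := M.sub_mod_mem 1 (by simp)
      rwa [M.map_one] at this
    · rintro x _ ⟨p, hp, rfl⟩
      obtain ⟨p₀, hp₀, hx⟩ := hlin x
      have hp := Polynomial.mem_degreeLT.1 hp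
      exact ⟨_, ⟨_, Polynomial.mem_degreeLT.2 (M.degree_mod_lt _), rfl⟩,
        M.linear_mul_mem (X_mem_restrictTotalDegree x)
          (restrictTotalDegree_mono (by omega) (M.map_mem p hp)) hp₀ hp hx
          (by rw [sub_self]; exact Submodule.zero_mem _)⟩
  obtain ⟨_, ⟨p, hp, rfl⟩, hw⟩ := hred
  exact ⟨p, Polynomial.mem_degreeLT.1 hp, hw⟩

end UnivariateModel

/-- A univariate polynomial over a finite field that vanishes at the rational roots of `h` lies in
the ideal generated by `h` and `X ^ #k - X`. -/
theorem exists_eq_mul_add_mul_of_forall_root {k : Type*} [Field k] [Finite k]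
    (h p : Polynomial k) (hp : ∀ x, h.IsRoot x → p.IsRoot x) :
    ∃ a c : Polynomial k, p = a * h + c * (Polynomial.X ^ Nat.card k - Polynomial.X) := by
  classical
  cases nonempty_fintype k
  rw [Nat.card_eq_fintype_card]
  set w : Polynomial k := Polynomial.X ^ Fintype.card k - Polynomial.X with hw
  have hw0 : w ≠ 0 := FiniteField.X_pow_card_sub_X_ne_zero k Fintype.one_lt_card
  -- The gcd divides X^{#k} - X, hence splits with simple roots, all of them rational roots of `h`.
  have hdvd : EuclideanDomain.gcd h w ∣ p := by
    rcases eq_or_ne p 0 with rfl | hp0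
    · exact dvd_zero _
    have hgw := EuclideanDomain.gcd_dvd_right h w
    have hg0 : EuclideanDomain.gcd h w ≠ 0 := ne_zero_of_dvd_ne_zero hw0 hgw
    have hsplit : w.Splits := by
      rw [Polynomial.splits_iff_card_roots, hw, FiniteField.roots_X_pow_card_sub_X,
        FiniteField.X_pow_card_sub_X_natDegree_eq k Fintype.one_lt_card]
      rfl
    refine (hsplit.of_dvd hw0 hgw).dvd_of_roots_le_roots hg0 ?_
    rw [Multiset.le_iff_subset]
    · intro x hx
      rw [Polynomial.mem_roots hg0] at hx
      rw [Polynomial.mem_roots hp0]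
      exact hp x (hx.dvd (EuclideanDomain.gcd_dvd_left h w))
    · refine Multiset.nodup_of_le (Polynomial.roots.le_of_dvd hw0 hgw) ?_
      rw [hw, FiniteField.roots_X_pow_card_sub_X]
      exact Finset.univ.nodup
  obtain ⟨c, rfl⟩ := hdvd
  refine ⟨EuclideanDomain.gcdA h w * c, EuclideanDomain.gcdB h w * c, ?_⟩
  conv_lhs => rw [EuclideanDomain.gcd_eq_gcd_ab]
  ring

end Univariate

/-! ### Reduction modulo the field equations -/

section FieldEquations

variable {σ K : Type*} [Field K] {q : ℕ}

/-- The remainder modulo the field equations `X_p ^ q - X_p`. -/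
def reduceMod (q : ℕ) : MvPolynomial σ K →ₗ[K] MvPolynomial σ K :=
  (basisMonomials σ K).constr K fun e =>
    monomial (e.mapRange (reduceExp q) (reduceExp_zero q)) 1

theorem reduceMod_monomial (e : σ →₀ ℕ) (c : K) :
    reduceMod q (monomial e c) = monomial (e.mapRange (reduceExp q) (reduceExp_zero q)) c := by
  rw [show monomial e c = c • basisMonomials σ K e by simp [smul_monomial], map_smul, reduceMod,
    Module.Basis.constr_basis, smul_monomial, smul_eq_mul, mul_one]

theorem reduceExp_add (hq : 2 ≤ q) (e : ℕ) : reduceExp q (q + e) = reduceExp q (1 + e) := by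
  unfold reduceExp
  rw [if_neg (by omega), if_neg (by omega), show q + e - 1 = e + (q - 1) by omega,
    Nat.add_mod_right, Nat.add_sub_cancel_left]

theorem reduceExp_of_lt {e : ℕ} (he : e < q) : reduceExp q e = e := by
  unfold reduceExp
  split_ifs with h
  · exact h.symm
  · rw [Nat.mod_eq_of_lt (by omega)]
    omega

/-- Congruent polynomials thus have the same remainder, however different their degrees. The
induction over the ideal runs for all multiples `u * f` at once. -/
theorem reduceMod_eq_zero (hq : 2 ≤ q) {f : MvPolynomial σ K}
    (hf : f ∈ Ideal.span {g : MvPolynomial σ K | ∃ p, g = X p ^ q - X p}) :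
    reduceMod q f = 0 := by
  suffices ∀ u : MvPolynomial σ K, reduceMod q (u * f) = 0 by simpa using this 1
  induction hf using Submodule.span_induction with
  | mem x hx =>
    obtain ⟨p, rfl⟩ := hx
    intro u
    induction u using MvPolynomial.induction_on' with
    | monomial e c =>
      have hexp : (e + Finsupp.single p q).mapRange (reduceExp q) (reduceExp_zero q) =
          (e + Finsupp.single p 1).mapRange (reduceExp q) (reduceExp_zero q) := by
        classical
        ext p'
        simp only [Finsupp.mapRange_apply, Finsupp.add_apply, Finsupp.single_apply]
        split_ifs
        · rw [add_comm, reduceExp_add hq, add_comm]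
        · rfl
      rw [mul_sub, map_sub, X_pow_eq_monomial, X, monomial_mul, monomial_mul,
        reduceMod_monomial, reduceMod_monomial, hexp, sub_self]
    | add a b ha hb => rw [add_mul, map_add, ha, hb, add_zero]
  | zero => simp
  | add x y _ _ hx hy => intro u; rw [mul_add, map_add, hx, hy, add_zero]
  | smul a x _ hx => intro u; rw [smul_eq_mul, ← mul_assoc, hx]

variable {G : Set (MvPolynomial σ K)} {B : ℕ}

theorem X_pow_sub_X_mem_constructibleUpTo (hq : 2 ≤ q) (hqB : q ≤ B)
    (hG : ∀ p, X p ^ q - X p ∈ G) (p : σ) :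
    (X p ^ q - X p : MvPolynomial σ K) ∈ constructibleUpTo G B q := by
  have hd : (X p ^ q - X p : MvPolynomial σ K) ∈ restrictTotalDegree σ K q := by
    refine Submodule.sub_mem _ ?_
      (restrictTotalDegree_mono (by omega) (X_mem_restrictTotalDegree p))
    simpa using pow_mem_restrictTotalDegree (X_mem_restrictTotalDegree (K := K) p) q
  refine ⟨subset_constructible (hG p) ?_, hd⟩
  rw [mem_restrictTotalDegree] at hd
  exact_mod_cast hd.trans hqB

theorem X_pow_sub_X_pow_reduceExp_mem (hq : 2 ≤ q) (hG : ∀ p, X p ^ q - X p ∈ G) (p : σ) (e : ℕ)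
    (he : e ≤ B) :
    (X p ^ e - X p ^ reduceExp q e : MvPolynomial σ K) ∈ constructibleUpTo G B e := by
  induction e using Nat.strong_induction_on with
  | _ e ih =>
    rcases lt_or_ge e q with h | h
    · rw [reduceExp_of_lt h, sub_self]
      exact Submodule.zero_mem _
    · obtain ⟨v, rfl⟩ := exists_add_of_le h
      have h1 := ih (1 + v) (by omega) (by omega)
      have h2 : (X p ^ v : MvPolynomial σ K) ∈ restrictTotalDegree σ K v := by
        simpa using pow_mem_restrictTotalDegree (X_mem_restrictTotalDegree (K := K) p) v
      have h3 := mul_mem_constructibleUpTo h2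
        (X_pow_sub_X_mem_constructibleUpTo hq (by omega : q ≤ B) hG p) (by omega)
      rw [reduceExp_add hq]
      convert Submodule.add_mem _ (constructibleUpTo_mono (show _ ≤ q + v by omega) h1)
        (constructibleUpTo_mono (show _ ≤ q + v by omega) h3) using 1
      rw [pow_add, pow_add, pow_one]
      ring

theorem reduceExp_le (q e : ℕ) : reduceExp q e ≤ e := by
  unfold reduceExp
  split_ifs with h
  · omega
  · have := Nat.mod_le (e - 1) (q - 1)
    omega

theorem sub_reduceMod_mem [Fintype σ] (hq : 2 ≤ q) (hG : ∀ p, X p ^ q - X p ∈ G)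
    {f : MvPolynomial σ K} (hf : f ∈ restrictTotalDegree σ K B) :
    f - reduceMod q f ∈ constructibleUpTo G B B := by
  rw [mem_restrictTotalDegree] at hf
  rw [f.as_sum, map_sum, ← Finset.sum_sub_distrib]
  refine Submodule.sum_mem _ fun e he => ?_
  have he' : ∑ p, e p ≤ B := (sum_le_totalDegree he).trans hf
  have hpow : ∀ (p : σ) (a : ℕ), (X p ^ a : MvPolynomial σ K) ∈ restrictTotalDegree σ K a :=
    fun p a => by simpa using pow_mem_restrictTotalDegree (X_mem_restrictTotalDegree (K := K) p) a
  have key := prod_sub_prod_mem_constructibleUpTo (F := G) (B := B) Finset.univ (fun p => e p)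
    (fun p => X p ^ e p) (fun p => X p ^ reduceExp q (e p)) (fun p _ => hpow p _)
    (fun p _ => restrictTotalDegree_mono (reduceExp_le q _) (hpow p _))
    (fun p _ => X_pow_sub_X_pow_reduceExp_mem hq hG p (e p)
      ((Finset.single_le_sum (f := fun p => e p) (fun _ _ => Nat.zero_le _)
        (Finset.mem_univ p)).trans he')) he'
  rw [reduceMod_monomial, monomial_eq, monomial_eq, Finsupp.prod_fintype _ _ (by simp),
    Finsupp.prod_fintype _ _ (by simp), ← mul_sub, ← smul_eq_C_mul]
  exact Submodule.smul_mem _ _ (constructibleUpTo_mono he' key)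

end FieldEquations

/-! ### Conjugate linear forms and the descent system -/

section Conjugates

variable {k' k : Type*} [Field k'] [Field k] [Algebra k' k] {m n : ℕ}

/-- The linear form `∑ l, α_l ^ q ^ j X_{i l}`. -/
def conjugateForm (q : ℕ) (α : Module.Basis (Fin n) k' k) (i : Fin m) (j : ℕ) :
    MvPolynomial (Fin m × Fin n) k :=
  ∑ l, C (α l ^ q ^ j) * X (i, l)

variable {q : ℕ} (α : Module.Basis (Fin n) k' k)

theorem conjugateForm_mem (i : Fin m) (j : ℕ) :
    conjugateForm q α i j ∈ restrictTotalDegree (Fin m × Fin n) k 1 := by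
  refine Submodule.sum_mem _ fun l _ => ?_
  rw [← smul_eq_C_mul]
  exact Submodule.smul_mem _ _ (X_mem_restrictTotalDegree _)

theorem conjugateForm_zero (i : Fin m) :
    conjugateForm q α i 0 = ∑ l, C (α l) * X (i, l) := by
  simp [conjugateForm]

theorem substituted_eq (f : MvPolynomial (Fin m) k) :
    substituted α f = aeval (fun i => conjugateForm q α i 0) f := by
  simp only [conjugateForm_zero]
  rfl

theorem sum_pow_card {A ι : Type*} [CommRing A] [Algebra k' A] [Finite k']
    (hq : Nat.card k' = q) (s : Finset ι) (f : ι → A) :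
    (∑ i ∈ s, f i) ^ q = ∑ i ∈ s, f i ^ q := by
  cases nonempty_fintype k'
  rw [Nat.card_eq_fintype_card] at hq
  subst hq
  exact map_sum (FiniteField.frobeniusAlgHom k' A) f s

theorem conjugateForm_pow_sub [Finite k'] (hq : Nat.card k' = q) (i : Fin m) (j : ℕ) :
    conjugateForm q α i j ^ q - conjugateForm q α i (j + 1) =
      ∑ l, α l ^ q ^ (j + 1) • (X (i, l) ^ q - X (i, l)) := by
  rw [conjugateForm, sum_pow_card hq, conjugateForm, ← Finset.sum_sub_distrib]
  refine Finset.sum_congr rfl fun l _ => ?_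
  rw [mul_pow, ← C_pow, ← pow_mul, ← pow_succ, ← mul_sub, smul_eq_C_mul]

theorem conjugateForm_card [Finite k] (hqn : Nat.card k = q ^ n) (i : Fin m) :
    conjugateForm q α i n = conjugateForm q α i 0 := by
  cases nonempty_fintype k
  rw [Nat.card_eq_fintype_card] at hqn
  rw [conjugateForm_zero, conjugateForm, ← hqn]
  simp only [FiniteField.pow_card]

/-- The variables are linear combinations of the conjugate forms, by Dedekind's independence of
the powers of the Frobenius. -/
theorem X_mem_span_conjugateForm [Finite k'] [Finite k] (hq : Nat.card k' = q)
    (p : Fin m × Fin n) :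
    (X p : MvPolynomial (Fin m × Fin n) k) ∈
      Submodule.span k {v | ∃ i j, v = conjugateForm q α i j} := by
  cases nonempty_fintype k'
  have hfin : Module.finrank k' k = n := by simpa using Module.finrank_eq_card_basis α
  have hcard : Fintype.card k' = q := by rw [← hq, Nat.card_eq_fintype_card]
  have : FiniteDimensional k' k := Module.Finite.of_basis α
  let N : Matrix (Fin n) (Fin n) k := fun j l => α l ^ q ^ (j : ℕ)
  have hN : LinearIndependent k N := by
    rw [Fintype.linearIndependent_iff]
    intro c hc
    have hind := (linearIndependent_algHom_toLinearMap k' k k).comp _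
      (FiniteField.bijective_frobeniusAlgHom_pow k' k).1
    subst hfin
    rw [Fintype.linearIndependent_iff] at hind
    refine hind c (α.ext fun l => ?_)
    have := congrFun hc l
    simp only [Finset.sum_apply, Pi.smul_apply] at this
    rw [LinearMap.sum_apply]
    simp only [Function.comp_apply, LinearMap.smul_apply, AlgHom.toLinearMap_apply]
    refine Eq.trans (Finset.sum_congr rfl fun j _ => ?_) this
    rw [AlgHom.coe_pow, FiniteField.coe_frobeniusAlgHom, pow_iterate, hcard]
  have hunit : IsUnit N := Matrix.linearIndependent_rows_iff_isUnit.1 hN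
  have hinv : N⁻¹ * N = 1 := Matrix.nonsing_inv_mul N ((Matrix.isUnit_iff_isUnit_det N).1 hunit)
  obtain ⟨i, l⟩ := p
  have key : (X (i, l) : MvPolynomial (Fin m × Fin n) k) =
      ∑ j : Fin n, N⁻¹ l j • conjugateForm q α i j := by
    simp only [conjugateForm, Finset.smul_sum, ← smul_eq_C_mul, smul_smul]
    rw [Finset.sum_comm]
    simp only [← Finset.sum_smul]
    have : ∀ l', ∑ j, N⁻¹ l j * α l' ^ q ^ (j : ℕ) = (1 : Matrix (Fin n) (Fin n) k) l l' :=
      fun l' => by rw [← hinv, Matrix.mul_apply]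
    simp only [this, Matrix.one_apply, ite_smul, one_smul, zero_smul, Finset.sum_ite_eq,
      Finset.mem_univ, if_true]
  rw [key]
  exact Submodule.sum_mem _ fun j _ =>
    Submodule.smul_mem _ _ (Submodule.subset_span ⟨i, j, rfl⟩)

theorem sum_weilComponent (f : MvPolynomial (Fin m) k) :
    ∑ j, C (α j) * map (algebraMap k' k) (weilComponent q α f j) =
      reduceMod q (substituted α f) := by
  conv_rhs => rw [(substituted α f).as_sum, map_sum]
  simp only [weilComponent, map_sum, map_monomial, Finset.mul_sum, C_mul_monomial,
    reduceMod_monomial]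
  rw [Finset.sum_comm]
  refine Finset.sum_congr rfl fun e _ => ?_
  rw [← map_sum]
  congr 1
  conv_rhs => rw [← α.sum_repr ((substituted α f).coeff e)]
  refine Finset.sum_congr rfl fun j _ => ?_
  rw [Algebra.smul_def, mul_comm]

/-- The `α j` are independent over `k'`, so coefficients of the `g j` cannot cancel. -/
theorem totalDegree_le_of_sum_mem {σ : Type*} {B : ℕ} {g : Fin n → MvPolynomial σ k'}
    (hg : ∑ j, C (α j) * map (algebraMap k' k) (g j) ∈ restrictTotalDegree σ k B) (j : Fin n) :
    (g j).totalDegree ≤ B := by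
  refine Finset.sup_le fun e he => ?_
  by_contra! hlt
  rw [mem_restrictTotalDegree] at hg
  have h0 : (∑ j, C (α j) * map (algebraMap k' k) (g j)).coeff e = 0 := by
    by_contra hne
    have := le_totalDegree (mem_support_iff.2 hne)
    exact absurd (hlt.trans_le (this.trans hg)) (lt_irrefl _)
  rw [coeff_sum] at h0
  simp only [coeff_C_mul, coeff_map] at h0
  refine mem_support_iff.1 he (Fintype.linearIndependent_iff.1 α.linearIndependent
    (fun j => (g j).coeff e) ?_ j)
  rw [← h0]
  exact Finset.sum_congr rfl fun j _ => by rw [Algebra.smul_def, mul_comm]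

theorem twist_sub_substituted_mem [Finite k'] (hq : Nat.card k' = q) (hq2 : 2 ≤ q)
    (f : MvPolynomial (Fin m) k) :
    twist q (conjugateForm q α) f - substituted α f ∈
      Ideal.span {g : MvPolynomial (Fin m × Fin n) k | ∃ p, g = X p ^ q - X p} := by
  rw [← Ideal.Quotient.eq]
  set I := Ideal.span {g : MvPolynomial (Fin m × Fin n) k | ∃ p, g = X p ^ q - X p}
  have hy : ∀ i j, Ideal.Quotient.mk I (conjugateForm q α i j) ^ q =
      Ideal.Quotient.mk I (conjugateForm q α i (j + 1)) := by
    intro i j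
    rw [← map_pow, Ideal.Quotient.eq, conjugateForm_pow_sub α hq]
    refine Submodule.sum_mem _ fun l _ => ?_
    rw [smul_eq_C_mul]
    exact Ideal.mul_mem_left _ _ (Ideal.subset_span ⟨_, rfl⟩)
  rw [substituted_eq (q := q), twist_apply]
  conv_rhs => rw [f.as_sum]
  rw [map_sum, map_sum, map_sum]
  refine Finset.sum_congr rfl fun e _ => ?_
  rw [aeval_monomial, Finsupp.prod_fintype _ _ (by simp), smul_eq_C_mul, map_mul, map_mul,
    map_prod, map_prod]
  congr 1
  refine Finset.prod_congr rfl fun i _ => ?_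
  rw [map_digitMonomial _ hq2, digitMonomial_eq_pow hq2 (hy i), map_pow]

/-- The Weil descent system, with coefficients extended to `k`. -/
abbrev extendedSystem (q : ℕ) (α : Module.Basis (Fin n) k' k) (F : Set (MvPolynomial (Fin m) k)) :
    Set (MvPolynomial (Fin m × Fin n) k) :=
  map (algebraMap k' k) '' weilDescentSystem q α F

variable {α} {F : Set (MvPolynomial (Fin m) k)}

theorem X_pow_sub_X_mem_extendedSystem (p : Fin m × Fin n) :
    X p ^ q - X p ∈ extendedSystem q α F :=
  ⟨X p ^ q - X p, Or.inr ⟨p, rfl⟩, by simp⟩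

theorem conjugateForm_pow_sub_mem [Finite k'] (hq : Nat.card k' = q) (hq2 : 2 ≤ q) {B : ℕ}
    (hqB : q ≤ B) (i : Fin m) (j : ℕ) :
    conjugateForm q α i j ^ q - conjugateForm q α i (j + 1) ∈
      constructibleUpTo (extendedSystem q α F) B q := by
  rw [conjugateForm_pow_sub α hq]
  exact Submodule.sum_mem _ fun l _ => Submodule.smul_mem _ _
    (X_pow_sub_X_mem_constructibleUpTo hq2 hqB X_pow_sub_X_mem_extendedSystem _)

/-- The twist of `f` and the possibly high-degree substitution have the same remainder ∑ α_j [f]_j.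
The twist reaches it within degree `B`, which also bounds each [f]_j and makes it available as a
generator. -/
theorem twist_mem_constructible_extendedSystem [Finite k'] (hq : Nat.card k' = q) (hq2 : 2 ≤ q)
    {B : ℕ} {f : MvPolynomial (Fin m) k} (hf : f ∈ F)
    (hfB : twist q (conjugateForm q α) f ∈ restrictTotalDegree _ k B) :
    twist q (conjugateForm q α) f ∈ constructible (extendedSystem q α F) B := by
  have h1 := sub_reduceMod_mem (G := extendedSystem q α F) hq2 X_pow_sub_X_mem_extendedSystem hfB
  have h2 : reduceMod q (twist q (conjugateForm q α) f) =
      ∑ j, C (α j) * map (algebraMap k' k) (weilComponent q α f j) := by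
    rw [sum_weilComponent, ← sub_eq_zero, ← map_sub]
    exact reduceMod_eq_zero hq2 (twist_sub_substituted_mem α hq hq2 f)
  have h3 : reduceMod q (twist q (conjugateForm q α) f) ∈ restrictTotalDegree _ k B := by
    have := Submodule.sub_mem _ hfB h1.2
    rwa [sub_sub_cancel] at this
  have h4 : reduceMod q (twist q (conjugateForm q α) f) ∈
      constructible (extendedSystem q α F) B := by
    rw [h2] at h3 ⊢
    refine Submodule.sum_mem _ fun j _ => ?_
    rw [← smul_eq_C_mul]
    refine Submodule.smul_mem _ _ (subset_constructible ⟨_, Or.inl ⟨f, hf, j, rfl⟩, rfl⟩ ?_)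
    exact_mod_cast (Finset.sup_mono (support_map_subset _ _)).trans
      (totalDegree_le_of_sum_mem α h3 j)
  simpa using Submodule.add_mem _ h1.1 h4

variable (α) in
/-- The point with coordinates in `k'` that corresponds to a point with coordinates in `k`. -/
def coordinatePoint (ξ : Fin m → k) (p : Fin m × Fin n) : k' := α.repr (ξ p.1) p.2

theorem eval_X_pow_sub_X [Finite k'] (hq : Nat.card k' = q) (ξ : Fin m → k) (p : Fin m × Fin n) :
    eval (algebraMap k' k ∘ coordinatePoint α ξ) (X p ^ q - X p) = 0 := by
  cases nonempty_fintype k'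
  rw [map_sub, map_pow, eval_X, Function.comp_apply, ← map_pow, ← hq, Nat.card_eq_fintype_card,
    FiniteField.pow_card, sub_self]

theorem eval_conjugateForm_zero (ξ : Fin m → k) (i : Fin m) :
    eval (algebraMap k' k ∘ coordinatePoint α ξ) (conjugateForm q α i 0) = ξ i := by
  rw [conjugateForm_zero, map_sum]
  conv_rhs => rw [← α.sum_repr (ξ i)]
  refine Finset.sum_congr rfl fun l _ => ?_
  rw [map_mul, eval_C, eval_X, Algebra.smul_def, mul_comm]
  rfl

theorem eval_twist [Finite k'] (hq : Nat.card k' = q) (hq2 : 2 ≤ q) (ξ : Fin m → k)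
    (f : MvPolynomial (Fin m) k) :
    eval (algebraMap k' k ∘ coordinatePoint α ξ) (twist q (conjugateForm q α) f) = eval ξ f := by
  have hy : ∀ i j, eval (algebraMap k' k ∘ coordinatePoint α ξ) (conjugateForm q α i j) ^ q =
      eval (algebraMap k' k ∘ coordinatePoint α ξ) (conjugateForm q α i (j + 1)) := by
    intro i j
    rw [← map_pow, ← sub_eq_zero, ← map_sub, conjugateForm_pow_sub α hq, map_sum]
    refine Finset.sum_eq_zero fun l _ => ?_
    rw [smul_eval, eval_X_pow_sub_X hq, mul_zero]
  rw [twist_apply, map_sum, eval_eq']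
  refine Finset.sum_congr rfl fun e _ => ?_
  rw [smul_eval, map_prod]
  congr 1
  refine Finset.prod_congr rfl fun i _ => ?_
  rw [map_digitMonomial _ hq2, digitMonomial_eq_pow hq2 (hy i), eval_conjugateForm_zero]

/-- The evaluation at the coordinates of a rational zero of `F` kills the Weil descent system. -/
theorem eval_eq_zero_of_mem_span [Finite k'] (hq : Nat.card k' = q) (hq2 : 2 ≤ q)
    {ξ : Fin m → k} (hξ : ∀ f ∈ F, eval ξ f = 0) {v : MvPolynomial (Fin m × Fin n) k}
    (hv : v ∈ Ideal.span (extendedSystem q α F)) :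
    eval (algebraMap k' k ∘ coordinatePoint α ξ) v = 0 := by
  have hfield : Ideal.span {g : MvPolynomial (Fin m × Fin n) k | ∃ p, g = X p ^ q - X p} ≤
      RingHom.ker (eval (algebraMap k' k ∘ coordinatePoint α ξ)) := by
    rw [Ideal.span_le]
    rintro _ ⟨p, rfl⟩
    exact eval_X_pow_sub_X hq ξ p
  suffices Ideal.span (extendedSystem q α F) ≤
      RingHom.ker (eval (algebraMap k' k ∘ coordinatePoint α ξ)) from this hv
  rw [Ideal.span_le]
  rintro _ ⟨g, ⟨f, hf, j, rfl⟩ | ⟨p, rfl⟩, rfl⟩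
  · have h1 := Ideal.add_mem _ (hfield (weilComponent_congr q hq2 α f))
      (hfield (twist_sub_substituted_mem α hq hq2 f))
    rw [sub_add_sub_comm, add_comm, add_sub_add_right_eq_sub, RingHom.mem_ker, map_sub,
      eval_twist hq hq2, hξ f hf, zero_sub, neg_eq_zero] at h1
    have h2 : ∀ g : MvPolynomial (Fin m × Fin n) k',
        eval (algebraMap k' k ∘ coordinatePoint α ξ) (map (algebraMap k' k) g) =
          algebraMap k' k (eval (coordinatePoint α ξ) g) := by
      intro g
      rw [eval_map, ← coe_aeval_eq_eval]
      exact aeval_algebraMap_apply k (coordinatePoint α ξ) g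
    have h3 := Fintype.linearIndependent_iff.1 α.linearIndependent
      (fun j => eval (coordinatePoint α ξ) (weilComponent q α f j)) (by
        rw [← h1, map_sum]
        refine Finset.sum_congr rfl fun j _ => ?_
        rw [map_mul, h2, eval_C, Algebra.smul_def, mul_comm]) j
    rw [SetLike.mem_coe, RingHom.mem_ker, h2, h3, map_zero]
  · exact hfield (Ideal.subset_span ⟨p, by simp⟩)

end Conjugates

/-! ### The bound for the descent system -/

section Main

theorem lastFallDegree_weilDescentSystem_le {k' k : Type*} [Field k'] [Field k] [Algebra k' k]
    [Finite k'] [Finite k] {q n m s r B₀ : ℕ} (hq : Nat.card k' = q) (hqn : Nat.card k = q ^ n)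
    (α : Module.Basis (Fin n) k' k) (F : Set (MvPolynomial (Fin m) k)) (hs : 1 ≤ s) (t : Fin m)
    {h : Polynomial k} {g : Fin m → Polynomial k} (hmonic : h.Monic) (hh : h.natDegree ≤ s)
    (hg : ∀ i, (g i).degree < s) (hmem : Polynomial.aeval (X t) h ∈ Ideal.span F)
    (hgmem : ∀ i, X i - Polynomial.aeval (X t) (g i) ∈ Ideal.span F)
    (hdvd : ∀ p : Polynomial k, Polynomial.aeval (X t) p ∈ Ideal.span F → h ∣ p)
    (hFr : lastFallDegree F ≤ r) (hsr : 2 * s ≤ r) (hqB : q ≤ B₀)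
    (hr : ∀ a b : Fin m → ℕ, ∑ i, a i + ∑ i, b i ≤ r →
      ∑ i, digitSum q (a i) + ∑ i, digitSum q (b i) ≤ B₀) :
    lastFallDegree (weilDescentSystem q α F) ≤ B₀ := by
  have hq2 : 2 ≤ q := hq ▸ Finite.one_lt_card
  refine sInf_le fun f' hf' => mem_constructible_of_map_mem (k := k) _ _ ?_
  obtain ⟨B, hB, hB₀, hfB⟩ : ∃ B : ℕ, (max (B₀ : ℕ∞) (f'.totalDegree : ℕ∞)) = B ∧ B₀ ≤ B ∧
      f'.totalDegree ≤ B :=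
    ⟨max B₀ f'.totalDegree, rfl, le_max_left _ _, le_max_right _ _⟩
  rw [hB]
  change map (algebraMap k' k) f' ∈ constructible (extendedSystem q α F) B
  set G := extendedSystem q α F with hG
  set f := map (algebraMap k' k) f' with hf
  have hfspan : f ∈ Ideal.span G := by
    have := Ideal.mem_map_of_mem (map (algebraMap k' k)) hf'
    rwa [Ideal.map_span] at this
  have hfB' : f ∈ restrictTotalDegree _ k B := by
    rw [mem_restrictTotalDegree]
    exact (Finset.sup_mono (support_map_subset _ _)).trans hfB
  have hr' : ∀ a b : Fin m → ℕ, ∑ i, a i + ∑ i, b i ≤ r →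
      ∑ i, digitSum q (a i) + ∑ i, digitSum q (b i) ≤ B := fun a b hab => (hr a b hab).trans hB₀
  have hy : ∀ i j, conjugateForm q α i j ∈ restrictTotalDegree (Fin m × Fin n) k 1 :=
    fun i j => conjugateForm_mem α i j
  have hyq : ∀ i j, conjugateForm q α i j ^ q - conjugateForm q α i (j + 1) ∈
      constructibleUpTo G B q :=
    conjugateForm_pow_sub_mem hq hq2 (hqB.trans hB₀)
  have htwist : ∀ v ∈ Ideal.span F, v.totalDegree ≤ r →
      twist q (conjugateForm q α) v ∈ constructible G B := by
    intro v hv hvr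
    refine twist_mem_constructible hq2 hy hyq hr' (fun v hv hvr => ?_)
      (mem_constructible_of_lastFallDegree_le hFr hv (by exact_mod_cast hvr))
    refine twist_mem_constructible_extendedSystem hq hq2 hv
      (twist_mem_restrictTotalDegree hq2 hy fun e he => ?_)
    have := hr' e 0 (by simp only [Pi.zero_apply, Finset.sum_const_zero]; omega)
    omega
  have hdeg : ∀ (p : Polynomial k) {d : ℕ}, p.natDegree ≤ d →
      (Polynomial.aeval (X t : MvPolynomial (Fin m) k) p).totalDegree ≤ d := fun p d hp =>
    (mem_restrictTotalDegree _ _ _).1 (aeval_X_mem_restrictTotalDegree t hp)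
  set u : Polynomial k →ₗ[k] MvPolynomial (Fin m × Fin n) k :=
    twist q (conjugateForm q α) ∘ₗ (Polynomial.aeval (X t)).toLinearMap with hu
  have hu' : ∀ p, u p = twist q (conjugateForm q α) (Polynomial.aeval (X t) p) := fun p => rfl
  have M : UnivariateModel G B s h u :=
    { two_le := by omega
      monic := hmonic
      natDegree_le := hh
      map_one := by
        rw [hu', map_one, ← C_1, C_apply, twist_monomial, one_smul]
        exact Finset.prod_eq_one fun i _ => digitMonomial_zero _
      map_mem := fun p hp => by
        rw [hu']
        refine twist_mem_restrictTotalDegree hq2 hy fun e he => ?_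
        have h1 := hdeg p (natDegree_le_of_degree_lt hp)
        -- The diagonal pair `(e, e)` gives the bound by half of `B`.
        have := hr' e e (by omega)
        omega
      mul_mem := fun p p' hp hp' => by
        have h1 := hdeg p (natDegree_le_of_degree_lt hp)
        have h2 := hdeg p' (natDegree_le_of_degree_lt hp')
        rw [hu', hu', hu', map_mul]
        exact twist_mul_sub_mem hq2 hy hyq hr' (by omega)
      dvd_mem := fun p hp hps => by
        refine htwist (Polynomial.aeval (X t) p) ?_ ((hdeg p hps).trans hsr)
        obtain ⟨c, rfl⟩ := hp
        rw [map_mul]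
        exact Ideal.mul_mem_right _ _ hmem }
  have hyg : ∀ i, conjugateForm q α i 0 - u (g i) ∈ constructible G B := by
    intro i
    have h1 : X i - Polynomial.aeval (X t) (g i) ∈ restrictTotalDegree (Fin m) k r :=
      Submodule.sub_mem _ (restrictTotalDegree_mono (by omega) (X_mem_restrictTotalDegree i))
        (aeval_X_mem_restrictTotalDegree t ((natDegree_le_of_degree_lt (hg i)).trans (by omega)))
    have h2 := htwist _ (hgmem i) ((mem_restrictTotalDegree _ _ _).1 h1)
    rwa [map_sub, twist_X hq2] at h2
  obtain ⟨p, hp, hfp⟩ := M.exists_sub_map_mem (hqB.trans hB₀) hy (fun i j => (hyq i j).1) hg hyg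
    (fun x => X_mem_span_conjugateForm α hq x) hfB'
  have hXg : h ∣ Polynomial.X - g t := hdvd _ (by
    rw [map_sub, Polynomial.aeval_X]
    exact hgmem t)
  have hroot : ∀ x, h.IsRoot x → p.IsRoot x := by
    intro x hx
    -- Substituting the `g i` in `v` gives a univariate polynomial congruent to `v` modulo the
    -- ideal, hence divisible by `h`.
    have hξ : ∀ v ∈ F, eval (fun i => (g i).eval x) v = 0 := by
      intro v hv
      have h1 : Polynomial.aeval (X t) (aeval g v) - v ∈ Ideal.span F := by
        have h0 : ((Ideal.Quotient.mkₐ k (Ideal.span F)).comp (Polynomial.aeval (X t))).comp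
            (aeval g) = Ideal.Quotient.mkₐ k (Ideal.span F) := by
          refine algHom_ext fun i => ?_
          rw [AlgHom.comp_apply, aeval_X, AlgHom.comp_apply, Ideal.Quotient.mkₐ_eq_mk, eq_comm,
            Ideal.Quotient.eq]
          exact hgmem i
        rw [← Ideal.Quotient.eq]
        exact DFunLike.congr_fun h0 v
      have h2 : h ∣ aeval g v := hdvd _ (by
        simpa using Ideal.add_mem _ h1 (Ideal.subset_span hv))
      have h3 : (aeval g v).eval x = 0 := hx.dvd h2
      rw [← h3, ← Polynomial.coe_aeval_eq_eval, ← coe_aeval_eq_eval]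
      exact (comp_aeval_apply g (Polynomial.aeval x) v).symm
    -- At this zero, `f` and `f - u p` both vanish, while `u p` takes the value p(g_t(x)) = p(x).
    have h1 := eval_eq_zero_of_mem_span (α := α) hq hq2 hξ hfspan
    have h2 := eval_eq_zero_of_mem_span (α := α) hq hq2 hξ (constructible_le_span hfp)
    rw [map_sub, h1, zero_sub, neg_eq_zero, hu', eval_twist hq hq2] at h2
    have h3 : (g t).eval x = x := by
      have : (Polynomial.X - g t).IsRoot x := hx.dvd hXg
      rw [Polynomial.IsRoot, Polynomial.eval_sub, Polynomial.eval_X, sub_eq_zero] at this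
      exact this.symm
    rw [← coe_aeval_eq_eval, RingHom.coe_coe, ← Polynomial.aeval_algHom_apply, aeval_X, h3] at h2
    simpa using h2
  obtain ⟨a, c, hpac⟩ := exists_eq_mul_add_mul_of_forall_root h p hroot
  rw [hqn] at hpac
  have := M.map_mem_of_mem_span (hqB.trans hB₀) (hy t) (fun j => (hyq t j).1) (hg t) (hyg t)
    (conjugateForm_card α hqn t) hXg hp hpac
  simpa using Submodule.add_mem _ hfp this

end Main

end WeilDescent

end

theorem theorem1p1 {k' k : Type*} [Field k'] [Field k] [Algebra k' k] [Finite k'] [Finite k]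
    (q n m s : ℕ) (hq : Nat.card k' = q) (hqn : Nat.card k = q ^ n)
    (α : Module.Basis (Fin n) k' k)
    (F : Finset (MvPolynomial (Fin m) k))
    (hs : 1 ≤ s)
    (hZ : (WeilDescent.zeroSet (F : Set (MvPolynomial (Fin m) k))).encard ≤ (s : ℕ∞))
    (hrad : (Ideal.span (F : Set (MvPolynomial (Fin m) k))).IsRadical)
    (hproj : ∃ t : Fin m, Set.InjOn (fun x : Fin m → AlgebraicClosure k => x t)
      (WeilDescent.zeroSet (F : Set (MvPolynomial (Fin m) k)))) :
    ∃ d : ℕ,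
      WeilDescent.lastFallDegree (F : Set (MvPolynomial (Fin m) k)) = (d : ℕ∞) ∧
      WeilDescent.lastFallDegree
          (WeilDescent.weilDescentSystem q α (F : Set (MvPolynomial (Fin m) k))) ≤
        ((max (max
            (WeilDescent.tau
              (max (max (max d (WeilDescent.systemDegree F)) ((m + 1) * s)) 1) q m)
            (m * WeilDescent.tau (2 * s) q 1))
          q : ℕ) : ℕ∞) := by
  obtain ⟨t, hinj⟩ := hproj
  obtain ⟨h, g, hmonic, hh, hg, hmem, hgmem, hdvd⟩ :=
    WeilDescent.exists_shape (K := AlgebraicClosure k) (F : Set (MvPolynomial (Fin m) k))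
      (V := WeilDescent.zeroSet (F : Set (MvPolynomial (Fin m) k))) rfl hZ hrad t hinj
  obtain ⟨d, hd⟩ := ENat.ne_top_iff_exists.1
    (WeilDescent.lastFallDegree_ne_top hs t hmonic hh hg hmem hgmem hdvd)
  have hq2 : 2 ≤ q := hq ▸ Finite.one_lt_card
  have hm : 0 < m := t.pos
  obtain ⟨r, hr⟩ : ∃ r, r = max (max (max d (WeilDescent.systemDegree F)) ((m + 1) * s)) 1 :=
    ⟨_, rfl⟩
  have hdr : d ≤ r := by omega
  -- The coordinate `t` forces `m ≥ 1`.
  have hsr : 2 * s ≤ r := by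
    have : 2 * s ≤ (m + 1) * s := Nat.mul_le_mul_right s (by omega)
    omega
  have hdr' : WeilDescent.lastFallDegree (F : Set (MvPolynomial (Fin m) k)) ≤ r := by
    rw [← hd]
    exact_mod_cast hdr
  have hr1 : 1 ≤ r := by omega
  have key := WeilDescent.lastFallDegree_weilDescentSystem_le
    (B₀ := max (max (WeilDescent.tau r q m) (m * WeilDescent.tau (2 * s) q 1)) q) hq hqn α
    (F : Set (MvPolynomial (Fin m) k)) hs t hmonic hh hg hmem hgmem hdvd hdr' hsr
    (le_max_right _ _) fun a b hab => le_max_of_le_left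
      (WeilDescent.sum_digitSum_add_le_max_tau hq2 hm hr1 hs a b hab)
  rw [hr] at key
  exact ⟨d, hd.symm, key⟩
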